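/- **Setting.** Finitely many items $j\in J$, with $k_j\ge k\ge 1$ units of item $j$, are sold to buyers $i=1,\dots,n$. Buyer $i$ has a finite, explicitly listed type space $T_i$; her type $t$ is drawn, independently of the other buyers, with probability $f_i(t)$. Type $t$ has an item value vector $v_t\in\mathbb R_{\ge 0}^J$ (so values of different items may be arbitrarily correlated), and the buyer has a public budget $B_i\ge 0$ and a public matroid $\mathcal M_i=(J,\mathcal I_i)$ with rank function $r_i$. The value of type $t$ for a bundle $S$ is the matroid weighted rank $\max_{I\subseteq S,\,I\in\mathcal I_i}\sum_{j\in I}v_{tj}$, which is $\sum_{j\in S}v_{tj}$ for $S\in\mathcal I_i$. The matroid is used either as an allocation constraint (only bundles $S\in\mathcal I_i$ may be allocated) or only through the valuation. A feasible single buyer mechanism maps a reported type to a joint law of a bundle (independent, in the constrained version) and a payment in $[0,B_i]$, and it is truthful in expectation. Interim individual rationality (non-negative expected utility of every truthful type) may be imposed in addition or not. Everything below holds for each choice of these two options for each buyer. **LP and mechanism (single buyer; index $i$ dropped).** For an ex ante cap $\bar x\in[0,1]^J$ let $R(\bar x)$ be the optimal value of $$\max\ \sum_t f(t)p_t\quad\text{s.t.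 } \sum_t f(t)x_{tj}\le\bar x_j,\ \ \sum_{j\in S}x_{tj}\le r(S),\ \ v_t\cdot x_t-p_t\ge v_t\cdot x_{t'}-p_{t'},\ \ x_t\in[0,1]^J,\ \ p_t\in[0,B]$$ for all $j$, $S\subseteq J$ and types $t,t'$, together with $v_t\cdot x_t-p_t\ge 0$ if individual rationality is imposed. The LP-based mechanism takes an optimal assignment $(x,p)$; on report $t$ it allocates a random independent set with marginals exactly $x_t$ (dependent rounding) and charges $p_t$. **Post-rounding.** For $\gamma\in[0,1]$ and breaking probabilities $x_0,x_1,\dots$ written on boxes, the $\gamma$-conservative magician is given by $F_0(w)=1$, $F_i(-1)=0$, $\theta_i=\min\{w\ge 0:F_i(w)\ge\gamma\}$; if $w$ wands are broken, it opens box $i$ with probability $s_i^w$, where $s_i^w=1$ for $w<\theta_i$, $s_i^w=0$ for $w>\theta_i$, and $s_i^{\theta_i}=\frac{\gamma-F_i(\theta_i-1)}{F_i(\theta_i)-F_i(\theta_i-1)}$; and $F_{i+1}(w)=s_i^wx_iF_i(w-1)+(1-s_i^wx_i)F_i(w)$. Let $\gamma_k$ be the largest $\gamma\in[0,1]$ such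 that for all $k'\ge k$ and all finite sequences $x_i\in[0,1]$ with $\sum_ix_i\le k'$ all thresholds satisfy $\theta_i<k'$. Choose caps $\bar x$ maximizing $\sum_iR_i(\bar x_i)$ subject to $\bar x_i\in[0,1]^J$ and $\sum_i\bar x_{ij}\le k_j$. Run the single buyer mechanisms with caps $\bar x_i$ independently on all buyers. Go through the buyers in order: for each item $j$ a $\gamma$-conservative magician with $k_j$ wands decides on a box that carries the exact ex ante probability that the mechanism of buyer $i$ allocates $j$; buyer $i$ keeps the tentatively allocated items whose boxes were opened (each kept item breaks one wand of its magician), and she pays $\gamma$ times her tentative payment. A multi buyer mechanism is feasible if it never allocates more than $k_j$ units of any item $j$ and the single buyer mechanism that it induces on each buyer $i$ (the types of the others being drawn from their priors) is feasible; in particular it is Bayesian incentive compatible (BIC). **Theorem.** 1. For every buyer and every cap $\bar x\in[0,1]^J$ the LP has an optimal assignment, and the marginals $x_t$ of every feasible assignment can be rounded to a random independent set with exactly these marginals. 2. Every LP-based mechanism with cap $\bar x\in[0,1]^J$ is feasible, allocates each item $j$ with ex ante probability at most $\bar x_j$, and has the largest expected revenue among all feasible single buyer mechanisms with this property. Its revenue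 is $R(\bar x)$, and it allocates item $j$ with ex ante probability exactly $\sum_tf(t)x_{tj}$. 3. It satisfies all requirements of post-rounding with approximation factor $1$: $R$ is concave on $[0,1]^J$ and is an upper bound on the revenue of every feasible mechanism under the cap; the mechanism is feasible, respects the cap and obtains at least $R(\bar x)$; its exact ex ante allocation probability for each item is computed from the numbers $f(t)$, $x_{tj}$ by at most $2|T|$ additions and multiplications; the objective (the revenue) is a non-negative multiple of the payment plus a function of type and bundle which has a budget balanced cross monotonic cost sharing scheme; and the valuations are matroid weighted rank functions. 4. Optimal caps exist, and for all optimal caps, all LP-based mechanisms of the buyers and every $\gamma\in[0,\gamma_k]$, the $\gamma$-post-rounding mechanism is a feasible (in particular BIC) multi buyer mechanism whose expected revenue is at least $\gamma$ times the expected revenue of every feasible multi buyer mechanism. For $\gamma=\gamma_k$ it is thus a $\gamma_k$-approximation. -/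

import Mathlib

open MeasureTheory Set
open scoped ENNReal BigOperators

noncomputable section

namespace CorrAuction

universe u v

/-! ### Matroid valuations -/

/-- The weighted rank function of a matroid: the largest weight of an independent subset of `S`. -/
def weightedRank {J : Type u} (M : Matroid J) (w : J → ℝ) (S : Finset J) : ℝ :=
  open Classical in
  (S.powerset.filter fun I : Finset J => M.Indep (I : Set J)).sup'
    ⟨∅, by simp⟩ fun I : Finset J => ∑ j ∈ I, w j

/-- On an independent set the weighted rank function is additive. -/
theorem weightedRank_of_indep {J : Type u} (M : Matroid J) (w : J → ℝ) (hw : ∀ j, 0 ≤ w j)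
    (S : Finset J) (hS : M.Indep (S : Set J)) : weightedRank M w S = ∑ j ∈ S, w j := by
  classical
  unfold weightedRank
  refine le_antisymm (Finset.sup'_le _ _ fun I hI => ?_)
    (Finset.le_sup' (fun I : Finset J => ∑ j ∈ I, w j) (by simp [hS]))
  simp only [Finset.mem_filter, Finset.mem_powerset] at hI
  exact Finset.sum_le_sum_of_subset_of_nonneg hI.1 fun j _ _ => hw j

/-- A set function is a matroid weighted rank valuation if it is the weighted rank function of some
matroid on the whole item set, for some non-negative weights. -/
def IsMatroidWeightedRank {J : Type u} (V : Finset J → ℝ) : Prop :=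
  ∃ M : Matroid J, M.E = univ ∧ ∃ w : J → ℝ, (∀ j, 0 ≤ w j) ∧ ∀ S, V S = weightedRank M w S

/-! ### A single buyer -/

/-- A buyer with a finite, explicitly listed type space `T`, a prior on it, a vector of item values
for each type (so values may be correlated arbitrarily), a public budget and a public matroid on the
items.

`constrained` says how the matroid enters: if `true`, only independent bundles may be allocated to
the buyer; if `false`, any bundle may be allocated and the matroid enters through the buyer's
valuation only.

`individuallyRational` says whether interim individual rationality (a truthful buyer has a
non-negative expected utility for each of her types) is imposed on mechanisms, in addition to
truthfulness. -/
structure Buyer (J : Type u) (T : Type v) [Fintype T] where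
  prob : T → ℝ
  prob_nonneg : ∀ t, 0 ≤ prob t
  prob_sum : ∑ t, prob t = 1
  val : T → J → ℝ
  val_nonneg : ∀ t j, 0 ≤ val t j
  budget : ℝ
  budget_nonneg : 0 ≤ budget
  mat : Matroid J
  ground : mat.E = univ
  constrained : Bool
  individuallyRational : Bool

namespace Buyer

variable {J : Type u} {T : Type v} [Fintype T]

/-- Value of type `t` for a bundle: the total value of the best independent part of the bundle. It
is the sum of the item values when the bundle is independent. -/
def value (b : Buyer J T) (t : T) (S : Finset J) : ℝ := weightedRank b.mat (b.val t) S

theorem value_of_indep (b : Buyer J T) (t : T) (S : Finset J) (hS : b.mat.Indep (S : Set J)) :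
    b.value t S = ∑ j ∈ S, b.val t j :=
  weightedRank_of_indep b.mat (b.val t) (b.val_nonneg t) S hS

/-- Expected quasi-linear utility of type `t` from a random pair (bundle, payment) of law `μ`. -/
def utility (b : Buyer J T) (t : T) (μ : Measure (Finset J × ℝ)) : ℝ :=
  ∫ o, (b.value t o.1 - o.2) ∂μ

/-- The feasible single buyer (direct, randomized) mechanisms. A mechanism maps a reported type to
the joint law of the allocated bundle and the payment. -/
structure IsFeasible (b : Buyer J T) (N : T → Measure (Finset J × ℝ)) : Prop where
  isProb : ∀ t, IsProbabilityMeasure (N t)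
  indep : b.constrained = true → ∀ t, ∀ᵐ o ∂(N t), b.mat.Indep (o.1 : Set J)
  payment : ∀ t, ∀ᵐ o ∂(N t), o.2 ∈ Icc 0 b.budget
  truthful : ∀ t t', b.utility t (N t') ≤ b.utility t (N t)
  rational : b.individuallyRational = true → ∀ t, 0 ≤ b.utility t (N t)

/-- Ex ante probability that item `j` is allocated. -/
def exAnte (b : Buyer J T) (N : T → Measure (Finset J × ℝ)) (j : J) : ℝ :=
  ∑ t, b.prob t * (N t).real {o | j ∈ o.1}

/-- Expected value of an objective `Φ (type) (bundle) (payment)`. -/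
def expected (b : Buyer J T) (Φ : T → Finset J → ℝ → ℝ) (N : T → Measure (Finset J × ℝ)) : ℝ :=
  ∑ t, b.prob t * ∫ o, Φ t o.1 o.2 ∂(N t)

/-- Expected revenue. -/
def revenue (b : Buyer J T) (N : T → Measure (Finset J × ℝ)) : ℝ :=
  b.expected (fun _ _ p => p) N

/-- `N` is a revenue-optimal truthful-in-expectation mechanism subject to the ex ante cap `q`. -/
def IsOptimalUnderCap (b : Buyer J T) (q : J → ℝ) (N : T → Measure (Finset J × ℝ)) : Prop :=
  b.IsFeasible N ∧ (∀ j, b.exAnte N j ≤ q j) ∧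
    ∀ N', b.IsFeasible N' → (∀ j, b.exAnte N' j ≤ q j) → b.revenue N' ≤ b.revenue N

/-! ### The linear program -/

/-- Feasible assignments of the linear program with cap `q`: `x t j` is the marginal probability of
allocating item `j` to type `t`, and `p t` is the payment of type `t`. -/
structure LPFeasible (b : Buyer J T) [Fintype J] (q : J → ℝ) (x : T → J → ℝ) (p : T → ℝ) : Prop where
  cap : ∀ j, ∑ t, b.prob t * x t j ≤ q j
  rank : ∀ t, ∀ S : Finset J, ∑ j ∈ S, x t j ≤ ((b.mat.eRk (S : Set J)).toNat : ℝ)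
  truthful : ∀ t t', ∑ j, b.val t j * x t' j - p t' ≤ ∑ j, b.val t j * x t j - p t
  rational : b.individuallyRational = true → ∀ t, 0 ≤ ∑ j, b.val t j * x t j - p t
  alloc : ∀ t j, x t j ∈ Icc (0 : ℝ) 1
  payment : ∀ t, p t ∈ Icc 0 b.budget

/-- Optimal assignments of the linear program. -/
def LPOptimal (b : Buyer J T) [Fintype J] (q : J → ℝ) (x : T → J → ℝ) (p : T → ℝ) : Prop :=
  b.LPFeasible q x p ∧
    ∀ x' p', b.LPFeasible q x' p' → ∑ t, b.prob t * p' t ≤ ∑ t, b.prob t * p t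

/-- The benchmark: the optimal value of the linear program as a function of the cap. -/
def benchmark (b : Buyer J T) [Fintype J] (q : J → ℝ) : ℝ :=
  sSup {r | ∃ x p, b.LPFeasible q x p ∧ r = ∑ t, b.prob t * p t}

end Buyer

/-! ### The LP-based mechanism -/

/-- The law `L` of a random set is a dependent rounding of `x`: it is supported on independent sets
and its marginals are exactly `x`. -/
structure IsRounding {J : Type u} [Fintype J] [DecidableEq J] (M : Matroid J) (x : J → ℝ)
    (L : PMF (Finset J)) : Prop where
  indep : ∀ S ∈ L.support, M.Indep (S : Set J)
  marginal : ∀ j, ∑ S : Finset J with j ∈ S, (L S).toReal = x j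

/-- The choices made by the LP-based mechanism: for each cap `q` an optimal assignment
`(alloc q, pay q)` of the linear program, and for each type a dependent rounding of its marginals. -/
structure LPMechanism {J : Type u} {T : Type v} [Fintype J] [DecidableEq J] [Fintype T]
    (b : Buyer J T) where
  alloc : (J → ℝ) → T → J → ℝ
  pay : (J → ℝ) → T → ℝ
  lottery : (J → ℝ) → T → PMF (Finset J)
  optimal : ∀ q ∈ Icc (0 : J → ℝ) 1, b.LPOptimal q (alloc q) (pay q)
  rounding : ∀ q ∈ Icc (0 : J → ℝ) 1, ∀ t, IsRounding b.mat (alloc q t) (lottery q t)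

/-- The LP-based mechanism: on report `t`, allocate the random set and charge the LP payment. -/
def LPMechanism.mech {J : Type u} {T : Type v} [Fintype J] [DecidableEq J] [Fintype T]
    {b : Buyer J T} (m : LPMechanism b) (q : J → ℝ) (t : T) : PMF (Finset J × ℝ) :=
  (m.lottery q t).map fun S => (S, m.pay q t)

/-- A mechanism with discrete outcome laws, as a mechanism. -/
def toMech {J : Type u} {T : Type v} (D : T → PMF (Finset J × ℝ)) (t : T) :
    Measure (Finset J × ℝ) :=
  (D t).toMeasure

/-! ### Requirements of post-rounding -/

/-- Arithmetic expressions over input registers indexed by `ι`. -/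
inductive ArithExpr (ι : Type v) : Type v
  | zero : ArithExpr ι
  | input : ι → ArithExpr ι
  | add : ArithExpr ι → ArithExpr ι → ArithExpr ι
  | mul : ArithExpr ι → ArithExpr ι → ArithExpr ι

/-- Value of an expression on given register contents. -/
def ArithExpr.eval {ι : Type v} (c : ι → ℝ) : ArithExpr ι → ℝ
  | .zero => 0
  | .input i => c i
  | .add e f => e.eval c + f.eval c
  | .mul e f => e.eval c * f.eval c

/-- Number of arithmetic operations of an expression. -/
def ArithExpr.ops {ι : Type v} : ArithExpr ι → ℕ
  | .zero => 0
  | .input _ => 0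
  | .add e f => e.ops + f.ops + 1
  | .mul e f => e.ops + f.ops + 1

/-- A set function has a budget balanced, cross monotonic cost sharing scheme. -/
def HasCostSharing {J : Type u} [DecidableEq J] (g : Finset J → ℝ) : Prop :=
  ∃ ξ : J → Finset J → ℝ, (∀ j S, 0 ≤ ξ j S) ∧ (∀ S, ∑ j ∈ S, ξ j S = g S) ∧
    ∀ j S S', ξ j (S ∪ S') ≤ ξ j S

/-- The requirements of post-rounding on one buyer, for an objective `Φ`, an approximation factor
`α`, a benchmark `R`, a family `D` of single buyer mechanisms indexed by the cap, and a table
`x q t j` of numbers which the mechanism with cap `q` has at hand. -/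
structure PostRoundingRequirements {J : Type u} {T : Type v} [Fintype J] [DecidableEq J] [Fintype T]
    (b : Buyer J T) (Φ : T → Finset J → ℝ → ℝ) (α : ℝ) (R : (J → ℝ) → ℝ)
    (D : (J → ℝ) → T → PMF (Finset J × ℝ)) (x : (J → ℝ) → T → J → ℝ) : Prop where
  /-- the benchmark is concave -/
  concave : ConcaveOn ℝ (Icc (0 : J → ℝ) 1) R
  /-- the benchmark is an upper bound on the optimum under the cap -/
  upper : ∀ q ∈ Icc (0 : J → ℝ) 1, ∀ N, b.IsFeasible N → (∀ j, b.exAnte N j ≤ q j) →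
    b.expected Φ N ≤ R q
  /-- the mechanism is feasible (in particular incentive compatible) and respects the cap -/
  feasible : ∀ q ∈ Icc (0 : J → ℝ) 1, b.IsFeasible (toMech (D q)) ∧
    ∀ j, b.exAnte (toMech (D q)) j ≤ q j
  /-- the mechanism is an `α`-approximation of the benchmark -/
  approx : ∀ q ∈ Icc (0 : J → ℝ) 1, α * R q ≤ b.expected Φ (toMech (D q))
  /-- the exact ex ante allocation probabilities are available: they are computed from the prior
  and the table by a fixed expression with linearly many operations -/
  exact_rule : ∀ j, ∃ e : ArithExpr (T ⊕ T), e.ops ≤ 2 * Fintype.card T ∧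
    ∀ q ∈ Icc (0 : J → ℝ) 1,
      b.exAnte (toMech (D q)) j = e.eval (Sum.elim b.prob fun t => x q t j)
  /-- the objective is linear in the payment -/
  linear : ∃ c : ℝ, 0 ≤ c ∧ ∀ t S p, Φ t S p = Φ t S 0 + c * p
  /-- the payment-free part of the objective has a cost sharing scheme -/
  cost_sharing : ∀ t, HasCostSharing fun S => Φ t S 0
  /-- valuations are matroid weighted rank functions -/
  valuations : ∀ t, IsMatroidWeightedRank (b.value t)

/-! ### The conservative magician

Boxes are numbered from `0`; `x i` is the breaking probability written on box `i`. -/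

/-- The smallest number of wands `w` with `F w ≥ γ`. -/
def thresholdOf (γ : ℝ) (F : ℕ → ℝ) : ℕ := sInf {w | γ ≤ F w}

/-- `F (w - 1)`, with value `0` for `w = 0`. -/
def prev (F : ℕ → ℝ) : ℕ → ℝ
  | 0 => 0
  | w + 1 => F w

/-- Probability of opening the current box when `w` wands are broken, if `F` is the distribution
function of the number of broken wands. -/
def openProbOf (γ : ℝ) (F : ℕ → ℝ) (w : ℕ) : ℝ :=
  if w < thresholdOf γ F then 1
  else if w = thresholdOf γ F then (γ - prev F w) / (F w - prev F w)
  else 0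

/-- Distribution function of the number of wands broken before box `i`. -/
def brokenCDF (γ : ℝ) (x : ℕ → ℝ) : ℕ → ℕ → ℝ
  | 0 => fun _ => 1
  | i + 1 => fun w =>
      openProbOf γ (brokenCDF γ x i) w * x i * prev (brokenCDF γ x i) w +
        (1 - openProbOf γ (brokenCDF γ x i) w * x i) * brokenCDF γ x i w

/-- Threshold of the `γ`-conservative magician for box `i`. -/
def threshold (γ : ℝ) (x : ℕ → ℝ) (i : ℕ) : ℕ := thresholdOf γ (brokenCDF γ x i)

/-- Probability with which the `γ`-conservative magician opens box `i` if `w` wands are broken. -/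
def openProb (γ : ℝ) (x : ℕ → ℝ) (i w : ℕ) : ℝ := openProbOf γ (brokenCDF γ x i) w

/-- The magician constant `γ_k`: the largest `γ` such that with any number `k' ≥ k` of wands, on any
finite sequence of boxes with breaking probabilities of sum at most `k'`, all thresholds of the
`γ`-conservative magician are less than `k'`. -/
def gammaConst (k : ℕ) : ℝ :=
  sSup {γ : ℝ | γ ∈ Icc (0 : ℝ) 1 ∧ ∀ k' ≥ k, ∀ (m : ℕ) (x : ℕ → ℝ),
    (∀ i, x i ∈ Icc (0 : ℝ) 1) → ∑ i ∈ Finset.range m, x i ≤ k' → ∀ i < m, threshold γ x i < k'}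

/-! ### Multi buyer mechanisms -/

section Multi

variable {J : Type u} {n : ℕ} {T : Fin n → Type v} [∀ i, Fintype (T i)]

/-- Probability of a type profile under the product of the priors. -/
def profileProb (b : ∀ i, Buyer J (T i)) (t : ∀ i, T i) : ℝ := ∏ i, (b i).prob (t i)

/-- The single buyer mechanism which buyer `i` perceives: the other buyers are simulated by drawing
their types from their priors (the drawn type of `i` herself is replaced by the report `r`). -/
def induced (b : ∀ i, Buyer J (T i))
    (M : (∀ i, T i) → Measure (Fin n → Finset J × ℝ)) (i : Fin n) (r : T i) :
    Measure (Finset J × ℝ) :=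
  ∑ t : ∀ i, T i, ENNReal.ofReal (profileProb b t) •
    (M (Function.update t i r)).map fun o => o i

/-- The feasible multi buyer mechanisms: for each type profile the supply constraints hold almost
surely, and the mechanism perceived by each buyer is feasible for her. In particular truth-telling
is a Bayes-Nash equilibrium (BIC): this is truthfulness of the induced mechanisms. -/
structure IsFeasibleMulti [DecidableEq J] (b : ∀ i, Buyer J (T i)) (units : J → ℕ)
    (M : (∀ i, T i) → Measure (Fin n → Finset J × ℝ)) : Prop where
  isProb : ∀ t, IsProbabilityMeasure (M t)
  supply : ∀ t j, ∀ᵐ o ∂(M t), (Finset.univ.filter fun i => j ∈ (o i).1).card ≤ units j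
  single : ∀ i, (b i).IsFeasible (induced b M i)

/-- Expected total revenue of a multi buyer mechanism. -/
def multiRevenue (b : ∀ i, Buyer J (T i))
    (M : (∀ i, T i) → Measure (Fin n → Finset J × ℝ)) : ℝ :=
  ∑ i, ∑ t : ∀ i, T i, profileProb b t * ∫ o, (o i).2 ∂(M t)

/-- Feasible caps of the multi buyer benchmark program. -/
def CapsFeasible (units : J → ℕ) (Q : Fin n → J → ℝ) : Prop :=
  (∀ i, Q i ∈ Icc (0 : J → ℝ) 1) ∧ ∀ j, ∑ i, Q i j ≤ units j

/-- Optimal caps of the multi buyer benchmark program, for single buyer benchmarks `R i`. -/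
def CapsOptimal (R : Fin n → (J → ℝ) → ℝ) (units : J → ℕ) (Q : Fin n → J → ℝ) : Prop :=
  CapsFeasible units Q ∧ ∀ Q', CapsFeasible units Q' → ∑ i, R i (Q' i) ≤ ∑ i, R i (Q i)

end Multi

/-! ### Post-rounding -/

/-- The random set which contains each item `j` independently with probability `p j`. (Numbers
outside `[0, 1]` are clamped; opening probabilities of magicians are not affected.) -/
def independentSubset {J : Type u} [Fintype J] [DecidableEq J] (p : J → ℝ) : PMF (Finset J) :=
  PMF.ofFintype
    (fun S => (∏ j ∈ S, min (ENNReal.ofReal (p j)) 1) *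
      ∏ j ∈ Sᶜ, (1 - min (ENNReal.ofReal (p j)) 1))
    (by
      rw [← Fintype.prod_add]
      exact Finset.prod_eq_one fun j _ => add_tsub_cancel_of_le (min_le_right _ _))

section PostRounding

variable {J : Type u} [Fintype J] [DecidableEq J] {n : ℕ} {T : Fin n → Type v} [∀ i, Fintype (T i)]

/-- The numbers written on the boxes of the magician of item `j`: box `i` carries the exact ex ante
probability that the mechanism of buyer `i` allocates item `j`. -/
def boxes (b : ∀ i, Buyer J (T i)) (D : ∀ i, T i → PMF (Finset J × ℝ)) (j : J) (i : ℕ) : ℝ :=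
  if h : i < n then (b ⟨i, h⟩).exAnte (toMech (D ⟨i, h⟩)) j else 0

/-- Processing buyer `i`, given the outcomes `o` of the earlier buyers: draw her tentative bundle and
payment from her single buyer mechanism, let the magician of each item `j` decide (with independent
coins) whether to open box `i`, given the number of wands of `j` broken so far, i.e. the number of
earlier buyers holding `j`; keep the tentatively allocated items whose boxes are opened and charge
`γ` times the tentative payment. As the tentative outcomes of different buyers are independent,
drawing them one by one is the same as drawing all of them at the beginning. -/
def postStep (b : ∀ i, Buyer J (T i)) (D : ∀ i, T i → PMF (Finset J × ℝ)) (γ : ℝ)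
    (t : ∀ i, T i) (i : Fin n) (o : Fin n → Finset J × ℝ) : PMF (Fin n → Finset J × ℝ) :=
  (D i (t i)).bind fun c =>
    (independentSubset fun j => openProb γ (boxes b D j) i
        (Finset.univ.filter fun l => l < i ∧ j ∈ (o l).1).card).map fun S =>
      Function.update o i (S ∩ c.1, γ * c.2)

/-- Outcomes after the first `m` buyers have been processed. -/
def postRun (b : ∀ i, Buyer J (T i)) (D : ∀ i, T i → PMF (Finset J × ℝ)) (γ : ℝ)
    (t : ∀ i, T i) : ℕ → PMF (Fin n → Finset J × ℝ)
  | 0 => PMF.pure fun _ => (∅, 0)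
  | m + 1 => (postRun b D γ t m).bind fun o =>
      if h : m < n then postStep b D γ t ⟨m, h⟩ o else PMF.pure o

/-- The `γ`-post-rounding multi buyer mechanism built from single buyer mechanisms `D i`. -/
def postRounding (b : ∀ i, Buyer J (T i)) (D : ∀ i, T i → PMF (Finset J × ℝ)) (γ : ℝ)
    (t : ∀ i, T i) : Measure (Fin n → Finset J × ℝ) :=
  (postRun b D γ t n).toMeasure

end PostRounding

end CorrAuction

end

open CorrAuction

open MeasureTheory Set
open scoped ENNReal BigOperators

noncomputable section

namespace CorrAuction

/-! ### Integrality of the matroid polytope -/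

section Rounding

variable {J : Type*} [Fintype J] [DecidableEq J]

/-! For one buyer, mechanisms and LP assignments translate into each other without loss. Replacing
each allocated bundle by its best independent part for the reported type keeps truthful utilities
and can only lower the value of a deviation, so every feasible mechanism yields an LP assignment
with the same revenue (`Buyer.IsFeasible.lpFeasible`). Conversely, the rank inequalities describe
the convex hull of the independent sets (`exists_isRounding`), and on independent bundles values are
additive, so a rounded assignment has exactly the LP utilities. Joint linearity of the constraints
makes the benchmark concave (`Buyer.concaveOn_benchmark`).

For several buyers, the ex ante allocation probabilities of any feasible mechanism are feasible
caps, because expected supply is respected. Hence the benchmark at optimal caps bounds every revenue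
(`IsFeasibleMulti.multiRevenue_le`).

Post-rounding attains exactly `γ` times this bound. Before buyer `i` is processed, the number of
broken wands does not depend on her type, and averaged over the earlier types it has the law that
the magician tracks (`sum_profileProb_countProb`). The opening probabilities are chosen so that each
box is then opened with probability `γ` (`IsCDF.sum_openProbOf_mul`). Thus all interim marginals
shrink by `γ` (`measureReal_mem_induced_postRounding`). Kept bundles are subsets of independent
sets, so utilities are still linear in the marginals and shrink by `γ` like the payments;
truthfulness and rationality survive.

Supply is respected on every run, since a box is never opened beyond the threshold, and the
threshold is below the number of wands. That this holds for all `γ` up to and including the supremum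
`gammaConst k` follows from continuity and monotonicity in `γ` of the magician's recursion,
rewritten with truncations (`threshold_lt_of_le_gammaConst`). -/

/-- A greedily chosen independent set is at least as heavy as every point of the matroid polytope. -/
theorem exists_basis_sum_ge (M : Matroid J) (hE : M.E = univ) (x : J → ℝ)
    (hr : ∀ S : Finset J, ∑ j ∈ S, x j ≤ ((M.eRk (S : Set J)).toNat : ℝ))
    (N : ℕ) (w : J → ℝ) (hw : ∀ j, 0 ≤ w j)
    (hN : (Finset.univ.filter fun j => 0 < w j).card ≤ N) :
    ∃ I : Finset J, M.IsBasis (I : Set J) {j | 0 < w j} ∧ ∑ j, w j * x j ≤ ∑ j ∈ I, w j := by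
  induction N generalizing w with
  | zero =>
    have h0 : ∀ j, w j = 0 := fun j => by
      by_contra h
      have : j ∈ Finset.univ.filter fun j => 0 < w j := by
        simpa using lt_of_le_of_ne (hw j) (Ne.symm h)
      rw [Finset.card_eq_zero.1 (Nat.le_zero.1 hN)] at this
      simp at this
    refine ⟨∅, ?_, by simp [h0]⟩
    have : {j | 0 < w j} = (∅ : Set J) := by ext j; simp [h0]
    rw [this]
    simp
  | succ N ih =>
    set P := Finset.univ.filter fun j => 0 < w j with hP
    rcases P.eq_empty_or_nonempty with hemp | hne
    · exact ih w hw (by rw [← hP, hemp]; simp)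
    obtain ⟨a, haP, hmin⟩ := P.exists_min_image w hne
    have ha : 0 < w a := by simpa [hP] using haP
    set c := w a with hc
    -- Peel off the lowest level: `w` equals `w'` plus `c` times the indicator of `P`, and `w'` has
    -- fewer positive entries.
    let w' : J → ℝ := fun j => if j ∈ P then w j - c else 0
    have hw' : ∀ j, 0 ≤ w' j := fun j => by
      by_cases h : j ∈ P
      · simpa [w', h] using hmin j h
      · simp [w', h]
    have hsub : (Finset.univ.filter fun j => 0 < w' j) ⊆ P.erase a := by
      intro j hj
      simp only [Finset.mem_filter, Finset.mem_univ, true_and] at hj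
      by_cases h : j ∈ P
      · refine Finset.mem_erase.2 ⟨?_, h⟩
        rintro rfl
        simp [w', h, hc] at hj
      · simp [w', h] at hj
    obtain ⟨I', hI', hle⟩ := ih w' hw' <| by
      have := Finset.card_le_card hsub
      rw [Finset.card_erase_of_mem haP] at this
      omega
    have hI'P : (I' : Set J) ⊆ P := fun j hj => by
      have : j ∈ (Finset.univ.filter fun j => 0 < w' j) := by simpa using hI'.subset hj
      exact Finset.mem_of_mem_erase (hsub this)
    -- Extending the basis of the upper level to a basis of `P` does not lower its `w'`-weight, and
    -- it brings the cardinality to the rank of `P`, which pays for the level `c`.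
    obtain ⟨B, hB, hIB⟩ := hI'.indep.subset_isBasis_of_subset hI'P (by simp [hE])
    obtain ⟨I, rfl⟩ : ∃ I : Finset J, (I : Set J) = B := ⟨B.toFinite.toFinset, by simp⟩
    have hPset : {j | 0 < w j} = (P : Set J) := by ext j; simp [hP]
    refine ⟨I, by rw [hPset]; exact hB, ?_⟩
    have hIP : I ⊆ P := by exact_mod_cast hB.subset
    have hcard : ((M.eRk (P : Set J)).toNat : ℝ) = I.card := by
      rw [← hB.encard_eq_eRk]; simp
    have h1 : ∑ j, w j * x j = ∑ j, w' j * x j + c * ∑ j ∈ P, x j := by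
      rw [Finset.mul_sum, ← Finset.sum_subset (Finset.subset_univ P), ← Finset.sum_subset
        (Finset.subset_univ P), ← Finset.sum_add_distrib]
      · refine Finset.sum_congr rfl fun j hj => ?_
        simp only [w', hj, if_true]; ring
      · intro j _ hj; simp [w', hj]
      · intro j _ hj
        have : w j = 0 := le_antisymm (by simpa [hP] using hj) (hw j)
        simp [this]
    have h2 : ∑ j ∈ I, w j = ∑ j ∈ I, w' j + c * I.card := by
      rw [mul_comm, ← nsmul_eq_mul, ← Finset.sum_const, ← Finset.sum_add_distrib]
      refine Finset.sum_congr rfl fun j hj => ?_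
      simp only [w', hIP hj, if_true]; ring
    have h3 : ∑ j ∈ I', w' j ≤ ∑ j ∈ I, w' j :=
      Finset.sum_le_sum_of_subset_of_nonneg (by exact_mod_cast hIB) fun j _ _ => hw' j
    have h4 := mul_le_mul_of_nonneg_left (hr P) ha.le
    rw [hcard] at h4
    linarith

/-- Negative weights can be cut off at zero: as `x` is non-negative this only raises the left side,
and a basis of the positive part uses no item whose weight was changed. -/
theorem exists_indep_sum_ge (M : Matroid J) (hE : M.E = univ) (x : J → ℝ) (hx : ∀ j, 0 ≤ x j)
    (hr : ∀ S : Finset J, ∑ j ∈ S, x j ≤ ((M.eRk (S : Set J)).toNat : ℝ)) (w : J → ℝ) :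
    ∃ I : Finset J, M.Indep (I : Set J) ∧ ∑ j, w j * x j ≤ ∑ j ∈ I, w j := by
  obtain ⟨I, hI, hle⟩ := exists_basis_sum_ge M hE x hr _ (fun j => max (w j) 0)
    (fun j => le_max_right _ _) le_rfl
  refine ⟨I, hI.indep, ?_⟩
  have h1 : ∑ j, w j * x j ≤ ∑ j, max (w j) 0 * x j :=
    Finset.sum_le_sum fun j _ => mul_le_mul_of_nonneg_right (le_max_left _ _) (hx j)
  have h2 : ∑ j ∈ I, max (w j) 0 = ∑ j ∈ I, w j := by
    refine Finset.sum_congr rfl fun j hj => max_eq_left ?_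
    have := hI.subset (Finset.mem_coe.2 hj)
    simp only [mem_ofPred_eq, lt_max_iff, lt_self_iff_false, or_false] at this
    exact this.le
  linarith

/-- Weights of lotteries over independent sets. -/
def lotteryWeights (M : Matroid J) : Set (Finset J → ℝ) :=
  {l | (∀ S, 0 ≤ l S) ∧ ∑ S, l S = 1 ∧ ∀ S : Finset J, ¬ M.Indep (S : Set J) → l S = 0}

/-- Marginals of a lottery. -/
def marginals (l : Finset J → ℝ) (j : J) : ℝ := ∑ S : Finset J with j ∈ S, l S

omit [DecidableEq J] in
theorem isCompact_lotteryWeights (M : Matroid J) : IsCompact (lotteryWeights M) := by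
  refine (isCompact_stdSimplex ℝ (Finset J)).of_isClosed_subset ?_
    fun l hl => ⟨hl.1, hl.2.1⟩
  simp only [lotteryWeights, ofPred_and, ofPred_forall]
  refine (isClosed_iInter fun S => isClosed_le continuous_const (continuous_apply S)).inter
    ((isClosed_eq (by fun_prop) continuous_const).inter (isClosed_iInter fun S =>
      isClosed_iInter fun _ => isClosed_eq (continuous_apply S) continuous_const))

theorem convex_marginals_image (M : Matroid J) : Convex ℝ (marginals '' lotteryWeights M) := by
  rintro _ ⟨l, hl, rfl⟩ _ ⟨l', hl', rfl⟩ a c ha hc hac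
  refine ⟨a • l + c • l', ⟨fun S => ?_, ?_, fun S hS => ?_⟩, ?_⟩
  · simpa using add_nonneg (mul_nonneg ha (hl.1 S)) (mul_nonneg hc (hl'.1 S))
  · simp [Finset.sum_add_distrib, ← Finset.mul_sum, hl.2.1, hl'.2.1, hac]
  · simp [hl.2.2 S hS, hl'.2.2 S hS]
  · ext j
    simp [marginals, Finset.sum_add_distrib, Finset.mul_sum]

theorem indicator_mem_marginals_image (M : Matroid J) (I : Finset J) (hI : M.Indep (I : Set J)) :
    (fun j => if j ∈ I then (1 : ℝ) else 0) ∈ marginals '' lotteryWeights M := by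
  refine ⟨fun S => if S = I then 1 else 0, ⟨fun S => ?_, by simp, fun S hS => ?_⟩, ?_⟩
  · dsimp only; split_ifs <;> norm_num
  · exact if_neg fun h : S = I => hS (h ▸ hI)
  · ext j
    simp [marginals, Finset.sum_ite_eq']

/-- Separation: the marginals of lotteries form a compact convex set. A functional separating `x`
from it would be a weight vector for which `x` beats every independent set, against
`exists_indep_sum_ge`. -/
theorem mem_marginals_image (M : Matroid J) (hE : M.E = univ) (x : J → ℝ) (hx : ∀ j, 0 ≤ x j)
    (hr : ∀ S : Finset J, ∑ j ∈ S, x j ≤ ((M.eRk (S : Set J)).toNat : ℝ)) :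
    x ∈ marginals '' lotteryWeights M := by
  by_contra hnot
  have hcont : Continuous (marginals : (Finset J → ℝ) → J → ℝ) :=
    continuous_pi fun j => by unfold marginals; fun_prop
  obtain ⟨f, u, h1, h2⟩ := geometric_hahn_banach_closed_point (convex_marginals_image M)
    ((isCompact_lotteryWeights M).image hcont).isClosed hnot
  have hf : ∀ y : J → ℝ, f y = ∑ j, f (Pi.single j 1) * y j := fun y => by
    conv_lhs => rw [← Finset.univ_sum_single y]
    rw [map_sum]
    refine Finset.sum_congr rfl fun j _ => ?_
    have : Pi.single j (y j) = y j • (Pi.single j (1 : ℝ) : J → ℝ) := by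
      rw [← Pi.single_smul]; simp
    rw [this, map_smul, smul_eq_mul, mul_comm]
  obtain ⟨I, hI, hle⟩ := exists_indep_sum_ge M hE x hx hr fun j => f (Pi.single j 1)
  have h3 := h1 _ (indicator_mem_marginals_image M I hI)
  rw [hf] at h2 h3
  simp only [mul_ite, mul_one, mul_zero, Finset.sum_ite_mem, Finset.univ_inter] at h3
  linarith

theorem exists_isRounding (M : Matroid J) (hE : M.E = univ) (x : J → ℝ) (hx : ∀ j, 0 ≤ x j)
    (hr : ∀ S : Finset J, ∑ j ∈ S, x j ≤ ((M.eRk (S : Set J)).toNat : ℝ)) :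
    ∃ L, IsRounding M x L := by
  obtain ⟨l, hl, rfl⟩ := mem_marginals_image M hE x hx hr
  refine ⟨PMF.ofFintype (fun S => ENNReal.ofReal (l S)) ?_, ⟨fun S hS => ?_, fun j => ?_⟩⟩
  · rw [← ENNReal.ofReal_sum_of_nonneg fun S _ => hl.1 S, hl.2.1, ENNReal.ofReal_one]
  · by_contra h
    simp [hl.2.2 S h] at hS
  · simp [marginals, ENNReal.toReal_ofReal, hl.1]

end Rounding

/-! ### Random pairs of a bundle and a payment -/

section Outcomes

variable {J : Type*} [Fintype J]

theorem ae_toMeasure_of_support {α : Type*} [MeasurableSpace α] [MeasurableSingletonClass α]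
    (p : PMF α) {P : α → Prop} (h : ∀ a ∈ p.support, P a) : ∀ᵐ a ∂p.toMeasure, P a := by
  rw [ae_iff, PMF.toMeasure_apply_eq_toOuterMeasure, PMF.toOuterMeasure_apply_eq_zero_iff,
    Set.disjoint_left]
  exact fun a ha hn => hn (h a ha)

theorem measurable_comp_bundle {β : Type*} [MeasurableSpace β] (g : Finset J → β) :
    Measurable fun o : Finset J × ℝ => g o.1 :=
  (Measurable.of_discrete (f := g)).comp measurable_fst

theorem integrable_comp_bundle (μ : Measure (Finset J × ℝ)) [IsFiniteMeasure μ]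
    (g : Finset J → ℝ) : Integrable (fun o => g o.1) μ :=
  Integrable.of_bound (measurable_comp_bundle g).aestronglyMeasurable (∑ S, |g S|)
    (Filter.Eventually.of_forall fun o =>
      Finset.single_le_sum (f := fun S => |g S|) (fun _ _ => abs_nonneg _) (Finset.mem_univ o.1))

omit [Fintype J] in
theorem integrable_payment {μ : Measure (Finset J × ℝ)} [IsFiniteMeasure μ] {B : ℝ}
    (h : ∀ᵐ o ∂μ, o.2 ∈ Icc 0 B) : Integrable (fun o => o.2) μ :=
  Integrable.of_bound measurable_snd.aestronglyMeasurable B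
    (h.mono fun o ho => by rw [Real.norm_of_nonneg ho.1]; exact ho.2)

/-- Linearity of expectation. The map `h` is the identity for the LP-based mechanism and the best
independent part for an arbitrary one. -/
theorem integral_sum_mul_mem [DecidableEq J] (μ : Measure (Finset J × ℝ)) [IsFiniteMeasure μ]
    (A : Finset J) (c : J → ℝ) (h : Finset J → Finset J) :
    ∫ o, ∑ j ∈ A, c j * (if j ∈ h o.1 then 1 else 0) ∂μ =
      ∑ j ∈ A, c j * μ.real {o | j ∈ h o.1} := by
  rw [integral_finsetSum _ fun j _ =>
    integrable_comp_bundle μ fun S => c j * (if j ∈ h S then 1 else 0)]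
  refine Finset.sum_congr rfl fun j _ => ?_
  rw [integral_const_mul]
  congr 1
  have hm : MeasurableSet {o : Finset J × ℝ | j ∈ h o.1} :=
    measurable_fst (MeasurableSet.of_discrete (s := {S : Finset J | j ∈ h S}))
  rw [← integral_indicator_one hm]
  exact integral_congr_ae (Filter.Eventually.of_forall fun o => by simp [Set.indicator])

end Outcomes

/-! ### A single buyer -/

namespace Buyer

variable {J : Type*} {T : Type*} [Fintype T]

theorem sum_le_value (b : Buyer J T) (t : T) {I S : Finset J} (hIS : I ⊆ S)
    (hI : b.mat.Indep (I : Set J)) : ∑ j ∈ I, b.val t j ≤ b.value t S := by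
  classical
  exact Finset.le_sup' (fun I : Finset J => ∑ j ∈ I, b.val t j) (by simp [hIS, hI])

theorem exists_value_eq (b : Buyer J T) (t : T) (S : Finset J) :
    ∃ I ⊆ S, b.mat.Indep (I : Set J) ∧ b.value t S = ∑ j ∈ I, b.val t j := by
  classical
  unfold value weightedRank
  obtain ⟨I, hI, h⟩ := Finset.exists_mem_eq_sup'
    (s := S.powerset.filter fun I : Finset J => b.mat.Indep (I : Set J)) ⟨∅, by simp⟩
    fun I : Finset J => ∑ j ∈ I, b.val t j
  rw [Finset.mem_filter, Finset.mem_powerset] at hI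
  exact ⟨I, hI.1, hI.2, h⟩

/-- The best independent part of a bundle. -/
def bestPart (b : Buyer J T) (t : T) (S : Finset J) : Finset J := (b.exists_value_eq t S).choose

theorem bestPart_subset (b : Buyer J T) (t : T) (S : Finset J) : b.bestPart t S ⊆ S :=
  (b.exists_value_eq t S).choose_spec.1

theorem bestPart_indep (b : Buyer J T) (t : T) (S : Finset J) :
    b.mat.Indep (b.bestPart t S : Set J) := (b.exists_value_eq t S).choose_spec.2.1

theorem value_eq_bestPart (b : Buyer J T) (t : T) (S : Finset J) :
    b.value t S = ∑ j ∈ b.bestPart t S, b.val t j := (b.exists_value_eq t S).choose_spec.2.2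

theorem isMatroidWeightedRank_value (b : Buyer J T) (t : T) : IsMatroidWeightedRank (b.value t) :=
  ⟨b.mat, b.ground, b.val t, b.val_nonneg t, fun _ => rfl⟩

variable [Fintype J]

/-- The expected utility depends only on marginals if bundles are independent and the payment is
deterministic. -/
theorem utility_eq_of_const_payment (b : Buyer J T) (t : T)
    (μ : Measure (Finset J × ℝ)) [IsProbabilityMeasure μ] (P : ℝ)
    (hi : ∀ᵐ o ∂μ, b.mat.Indep (o.1 : Set J)) (hp : ∀ᵐ o ∂μ, o.2 = P) :
    b.utility t μ = ∑ j, b.val t j * μ.real {o | j ∈ o.1} - P := by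
  classical
  have hs : ∫ o, ∑ j, b.val t j * (if j ∈ o.1 then 1 else 0) ∂μ =
      ∑ j, b.val t j * μ.real {o | j ∈ o.1} := integral_sum_mul_mem μ Finset.univ (b.val t) id
  have : b.utility t μ =
      ∫ o, (∑ j, b.val t j * (if j ∈ o.1 then 1 else 0) - P) ∂μ := by
    refine integral_congr_ae ?_
    filter_upwards [hi, hp] with o h1 h2
    rw [b.value_of_indep t o.1 h1, h2]
    simp
  rw [this, integral_sub (integrable_comp_bundle μ fun S =>
    ∑ j, b.val t j * (if j ∈ S then 1 else 0)) (integrable_const P), hs]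
  simp

/-- Marginals of the best independent part, and expected payments, of a feasible mechanism form a
feasible assignment of the linear program. -/
theorem IsFeasible.lpFeasible {b : Buyer J T} {N : T → Measure (Finset J × ℝ)}
    (h : b.IsFeasible N) {q : J → ℝ} (hq : ∀ j, b.exAnte N j ≤ q j) :
    b.LPFeasible q (fun t j => (N t).real {o | j ∈ b.bestPart t o.1})
      (fun t => ∫ o, o.2 ∂(N t)) := by
  classical
  have hP := h.isProb
  have hu : ∀ t t', b.utility t (N t') =
      ∫ o, b.value t o.1 ∂(N t') - ∫ o, o.2 ∂(N t') := fun t t' =>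
    integral_sub (integrable_comp_bundle _ _) (integrable_payment (h.payment t'))
  have hsum : ∀ t t', ∑ j, b.val t j * (N t').real {o | j ∈ b.bestPart t' o.1} =
      ∫ o, ∑ j ∈ b.bestPart t' o.1, b.val t j ∂(N t') := fun t t' => by
    rw [← integral_sum_mul_mem]
    simp
  have htrue : ∀ t, ∑ j, b.val t j * (N t).real {o | j ∈ b.bestPart t o.1} -
      ∫ o, o.2 ∂(N t) = b.utility t (N t) := fun t => by
    rw [hu, hsum]
    simp only [value_eq_bestPart]
  -- Best parts are needed because in the unconstrained version bundles may be dependent and their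
  -- raw marginals may violate the rank inequalities. Passing to parts only decreases marginals, so
  -- the cap is kept.
  refine ⟨fun j => (Finset.sum_le_sum fun t _ => ?_).trans (hq j), fun t S => ?_,
    fun t t' => ?_, fun hir t => ?_, fun t j => ⟨measureReal_nonneg, measureReal_le_one⟩,
    fun t => ⟨?_, ?_⟩⟩
  · exact mul_le_mul_of_nonneg_left
      (measureReal_mono fun o ho => b.bestPart_subset t o.1 ho) (b.prob_nonneg t)
  · have := integral_sum_mul_mem (N t) S (fun _ => 1) (b.bestPart t)
    simp only [one_mul] at this
    rw [← this]
    refine (integral_mono (integrable_comp_bundle _ fun R =>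
      ∑ j ∈ S, if j ∈ b.bestPart t R then (1 : ℝ) else 0) 
      (integrable_const ((b.mat.eRk (S : Set J)).toNat : ℝ)) fun o => ?_).trans_eq (by simp)
    have hind : b.mat.Indep ((S ∩ b.bestPart t o.1 : Finset J) : Set J) :=
      (b.bestPart_indep t o.1).subset (by simp)
    have hle : (S ∩ b.bestPart t o.1).card ≤ (b.mat.eRk (S : Set J)).toNat := by
      have h1 : ((S ∩ b.bestPart t o.1 : Finset J) : Set J).encard ≤ b.mat.eRk (S : Set J) :=
        hind.encard_le_eRk_of_subset (by simp)
      rw [Set.encard_coe_eq_coe_finsetCard] at h1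
      have h2 : b.mat.eRk (S : Set J) ≠ ⊤ :=
        ((b.mat.eRk_le_encard _).trans_lt (by simp)).ne
      exact (ENat.natCast_le_natCast.1 (by rwa [ENat.natCast_toNat h2]))
    simpa [Finset.sum_ite_mem] using hle
  -- For a deviation, the part that is best for `t'` is still independent, so type `t` values the
  -- whole bundle at least as much. The LP deviation is therefore no more attractive than the real
  -- one, while truthful utilities agree.
  · rw [htrue]
    refine le_trans ?_ (h.truthful t t')
    rw [hu, hsum]
    refine sub_le_sub_right (integral_mono (integrable_comp_bundle _ fun S =>
      ∑ j ∈ b.bestPart t' S, b.val t j) (integrable_comp_bundle _ _) fun o => ?_) _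
    exact b.sum_le_value t (b.bestPart_subset t' o.1) (b.bestPart_indep t' o.1)
  · rw [htrue]; exact h.rational hir t
  · exact integral_nonneg_of_ae ((h.payment t).mono fun o ho => ho.1)
  · exact (integral_mono_ae (integrable_payment (h.payment t)) (integrable_const b.budget)
      ((h.payment t).mono fun o ho => ho.2)).trans_eq (by simp)

/-! ### The linear program -/

/-- Graph of the feasible set of the linear program over all caps in the unit cube. -/
def lpGraph (b : Buyer J T) : Set ((J → ℝ) × (T → J → ℝ) × (T → ℝ)) :=
  {z | z.1 ∈ Icc (0 : J → ℝ) 1 ∧ b.LPFeasible z.1 z.2.1 z.2.2}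

/-- The conditions are closed and confine the point to a box. The cap is kept as a variable: slices
give optimal assignments, products over buyers give optimal caps. -/
theorem isCompact_lpGraph (b : Buyer J T) : IsCompact b.lpGraph := by
  refine (isCompact_Icc (a := ((0, 0, 0) : (J → ℝ) × (T → J → ℝ) × (T → ℝ)))
    (b := (1, 1, fun _ => b.budget))).of_isClosed_subset ?_ fun z hz => ?_
  · have : b.lpGraph = {z | z.1 ∈ Icc (0 : J → ℝ) 1 ∧
        (∀ j, ∑ t, b.prob t * z.2.1 t j ≤ z.1 j) ∧
        (∀ t, ∀ S : Finset J, ∑ j ∈ S, z.2.1 t j ≤ ((b.mat.eRk (S : Set J)).toNat : ℝ)) ∧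
        (∀ t t', ∑ j, b.val t j * z.2.1 t' j - z.2.2 t' ≤ ∑ j, b.val t j * z.2.1 t j - z.2.2 t) ∧
        (b.individuallyRational = true → ∀ t, 0 ≤ ∑ j, b.val t j * z.2.1 t j - z.2.2 t) ∧
        (∀ t j, z.2.1 t j ∈ Icc (0 : ℝ) 1) ∧ ∀ t, z.2.2 t ∈ Icc 0 b.budget} := by
      ext z
      exact ⟨fun h => ⟨h.1, h.2.cap, h.2.rank, h.2.truthful, h.2.rational, h.2.alloc,
        h.2.payment⟩, fun ⟨h0, h1, h2, h3, h4, h5, h6⟩ => ⟨h0, h1, h2, h3, h4, h5, h6⟩⟩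
    rw [this]
    simp only [ofPred_and, ofPred_forall]
    refine (isClosed_Icc.preimage continuous_fst).inter
      (IsClosed.inter (isClosed_iInter fun _ => isClosed_le (by fun_prop) (by fun_prop))
      (IsClosed.inter (isClosed_iInter fun _ => isClosed_iInter fun _ =>
        isClosed_le (by fun_prop) (by fun_prop))
      (IsClosed.inter (isClosed_iInter fun _ => isClosed_iInter fun _ =>
        isClosed_le (by fun_prop) (by fun_prop))
      (IsClosed.inter (isClosed_iInter fun _ => isClosed_iInter fun _ =>
        isClosed_le (by fun_prop) (by fun_prop))
      (IsClosed.inter (isClosed_iInter fun _ => isClosed_iInter fun _ =>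
        isClosed_Icc.preimage (by fun_prop))
      (isClosed_iInter fun _ => isClosed_Icc.preimage (by fun_prop)))))))
  · obtain ⟨h0, h⟩ := hz
    exact ⟨⟨h0.1, fun t j => (h.alloc t j).1, fun t => (h.payment t).1⟩,
      ⟨h0.2, fun t j => (h.alloc t j).2, fun t => (h.payment t).2⟩⟩

theorem lpFeasible_zero (b : Buyer J T) {q : J → ℝ} (hq : 0 ≤ q) : b.LPFeasible q 0 0 :=
  ⟨fun j => by simpa using hq j, fun _ _ => by simp, fun _ _ => by simp, fun _ _ => by simp,
    fun _ _ => by simp, fun _ => by simp [b.budget_nonneg]⟩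

theorem exists_lpOptimal (b : Buyer J T) {q : J → ℝ} (hq : q ∈ Icc (0 : J → ℝ) 1) :
    ∃ x p, b.LPOptimal q x p := by
  have hc : IsCompact (b.lpGraph ∩ {z | z.1 = q}) :=
    b.isCompact_lpGraph.inter_right (isClosed_eq continuous_fst continuous_const)
  obtain ⟨z, ⟨hz, rfl⟩, hmax⟩ := hc.exists_isMaxOn
    ⟨(q, 0, 0), ⟨hq, b.lpFeasible_zero hq.1⟩, rfl⟩
    (f := fun z => ∑ t, b.prob t * z.2.2 t) (by fun_prop)
  exact ⟨z.2.1, z.2.2, hz.2, fun x' p' h' => hmax (a := (z.1, x', p')) ⟨⟨hq, h'⟩, rfl⟩⟩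

theorem LPOptimal.benchmark_eq {b : Buyer J T} {q : J → ℝ} {x : T → J → ℝ} {p : T → ℝ}
    (h : b.LPOptimal q x p) : b.benchmark q = ∑ t, b.prob t * p t := by
  refine IsGreatest.csSup_eq ⟨⟨x, p, h.1, rfl⟩, ?_⟩
  rintro _ ⟨x', p', h', rfl⟩
  exact h.2 x' p' h'

theorem LPFeasible.le_benchmark {b : Buyer J T} {q : J → ℝ} {x : T → J → ℝ} {p : T → ℝ}
    (h : b.LPFeasible q x p) (hq : q ∈ Icc (0 : J → ℝ) 1) :
    ∑ t, b.prob t * p t ≤ b.benchmark q := by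
  obtain ⟨x', p', h'⟩ := b.exists_lpOptimal hq
  rw [h'.benchmark_eq]
  exact h'.2 x p h

theorem IsFeasible.revenue_le_benchmark {b : Buyer J T} {N : T → Measure (Finset J × ℝ)}
    (h : b.IsFeasible N) {q : J → ℝ} (hq : q ∈ Icc (0 : J → ℝ) 1) (hN : ∀ j, b.exAnte N j ≤ q j) :
    b.revenue N ≤ b.benchmark q :=
  (h.lpFeasible hN).le_benchmark hq

/-- Every constraint is jointly linear in cap, marginals and payments; concavity of the benchmark
rests on this. -/
theorem LPFeasible.convexComb {b : Buyer J T} {q q' : J → ℝ} {x x' : T → J → ℝ} {p p' : T → ℝ}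
    (h : b.LPFeasible q x p) (h' : b.LPFeasible q' x' p') {a c : ℝ} (ha : 0 ≤ a) (hc : 0 ≤ c)
    (hac : a + c = 1) :
    b.LPFeasible (a • q + c • q') (a • x + c • x') (a • p + c • p') := by
  have hval : ∀ t t', ∑ j, b.val t j * (a • x + c • x') t' j - (a • p + c • p') t' =
      a * (∑ j, b.val t j * x t' j - p t') + c * (∑ j, b.val t j * x' t' j - p' t') := by
    intro t t'
    simp only [Pi.add_apply, Pi.smul_apply, smul_eq_mul, mul_add, Finset.sum_add_distrib,
      mul_sub, Finset.mul_sum, mul_left_comm]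
    ring
  refine ⟨fun j => ?_, fun t S => ?_, fun t t' => ?_, fun hir t => ?_, fun t j => ?_, fun t => ?_⟩
  · have : ∑ t, b.prob t * (a • x + c • x') t j =
        a * ∑ t, b.prob t * x t j + c * ∑ t, b.prob t * x' t j := by
      simp only [Pi.add_apply, Pi.smul_apply, smul_eq_mul, mul_add, Finset.sum_add_distrib,
        Finset.mul_sum, mul_left_comm]
    rw [this]
    exact add_le_add (mul_le_mul_of_nonneg_left (h.cap j) ha)
      (mul_le_mul_of_nonneg_left (h'.cap j) hc)
  · have : ∑ j ∈ S, (a • x + c • x') t j = a * ∑ j ∈ S, x t j + c * ∑ j ∈ S, x' t j := by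
      simp only [Pi.add_apply, Pi.smul_apply, smul_eq_mul, Finset.sum_add_distrib, Finset.mul_sum]
    rw [this]
    refine (add_le_add (mul_le_mul_of_nonneg_left (h.rank t S) ha)
      (mul_le_mul_of_nonneg_left (h'.rank t S) hc)).trans_eq ?_
    rw [← add_mul, hac, one_mul]
  · rw [hval, hval]
    exact add_le_add (mul_le_mul_of_nonneg_left (h.truthful t t') ha)
      (mul_le_mul_of_nonneg_left (h'.truthful t t') hc)
  · rw [hval]
    exact add_nonneg (mul_nonneg ha (h.rational hir t)) (mul_nonneg hc (h'.rational hir t))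
  · exact convex_Icc (0 : ℝ) 1 (h.alloc t j) (h'.alloc t j) ha hc hac
  · exact convex_Icc 0 b.budget (h.payment t) (h'.payment t) ha hc hac

theorem concaveOn_benchmark (b : Buyer J T) : ConcaveOn ℝ (Icc (0 : J → ℝ) 1) b.benchmark := by
  refine ⟨convex_Icc _ _, fun q hq q' hq' a c ha hc hac => ?_⟩
  obtain ⟨x, p, h⟩ := b.exists_lpOptimal hq
  obtain ⟨x', p', h'⟩ := b.exists_lpOptimal hq'
  rw [h.benchmark_eq, h'.benchmark_eq]
  refine le_trans (le_of_eq ?_) ((h.1.convexComb h'.1 ha hc hac).le_benchmark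
    (convex_Icc _ _ hq hq' ha hc hac))
  simp only [Pi.add_apply, Pi.smul_apply, smul_eq_mul, mul_add, Finset.sum_add_distrib,
    Finset.mul_sum, mul_left_comm]

end Buyer

/-! ### The LP-based mechanism -/

namespace LPMechanism

variable {J : Type*} {T : Type*} [Fintype J] [DecidableEq J] [Fintype T] {b : Buyer J T}

theorem indep_of_mem_support (m : LPMechanism b) {q : J → ℝ} (hq : q ∈ Icc (0 : J → ℝ) 1) (t : T)
    {o : Finset J × ℝ} (ho : o ∈ (m.mech q t).support) : b.mat.Indep (o.1 : Set J) := by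
  obtain ⟨S, hS, rfl⟩ := (PMF.mem_support_map_iff _ _ _).1 ho
  exact (m.rounding q hq t).indep S hS

theorem payment_of_mem_support (m : LPMechanism b) {q : J → ℝ} (t : T)
    {o : Finset J × ℝ} (ho : o ∈ (m.mech q t).support) : o.2 = m.pay q t := by
  obtain ⟨S, hS, rfl⟩ := (PMF.mem_support_map_iff _ _ _).1 ho
  rfl

instance isProbabilityMeasure_toMech (D : T → PMF (Finset J × ℝ)) (t : T) :
    IsProbabilityMeasure (toMech D t) := by unfold toMech; infer_instance

theorem measureReal_mem (m : LPMechanism b) {q : J → ℝ} (hq : q ∈ Icc (0 : J → ℝ) 1) (t : T)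
    (j : J) : (toMech (m.mech q) t).real {o | j ∈ o.1} = m.alloc q t j := by
  have hm : MeasurableSet {o : Finset J × ℝ | j ∈ o.1} :=
    measurable_fst (MeasurableSet.of_discrete (s := {S : Finset J | j ∈ S}))
  rw [← (m.rounding q hq t).marginal j, measureReal_def, toMech, mech,
    PMF.toMeasure_map_apply _ _ _ Measurable.of_discrete hm, PMF.toMeasure_apply_fintype,
    ENNReal.toReal_sum, Finset.sum_filter]
  · refine Finset.sum_congr rfl fun S _ => ?_
    by_cases h : j ∈ S <;> simp [h]
  · intro S _
    exact ((Set.indicator_le_self _ _ S).trans_lt (PMF.apply_lt_top _ S)).ne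

theorem utility_mech (m : LPMechanism b) {q : J → ℝ} (hq : q ∈ Icc (0 : J → ℝ) 1) (t t' : T) :
    b.utility t (toMech (m.mech q) t') = ∑ j, b.val t j * m.alloc q t' j - m.pay q t' := by
  rw [b.utility_eq_of_const_payment t (toMech (m.mech q) t') (m.pay q t')
    (ae_toMeasure_of_support _ fun o ho => m.indep_of_mem_support hq t' ho)
    (ae_toMeasure_of_support _ fun o ho => m.payment_of_mem_support t' ho)]
  simp only [m.measureReal_mem hq]

theorem isFeasible_mech (m : LPMechanism b) {q : J → ℝ} (hq : q ∈ Icc (0 : J → ℝ) 1) :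
    b.IsFeasible (toMech (m.mech q)) where
  isProb _ := inferInstance
  indep _ t := ae_toMeasure_of_support _ fun o ho => m.indep_of_mem_support hq t ho
  payment t := ae_toMeasure_of_support _ fun o ho => by
    rw [m.payment_of_mem_support t ho]
    exact (m.optimal q hq).1.payment t
  truthful t t' := by
    rw [m.utility_mech hq, m.utility_mech hq]
    exact (m.optimal q hq).1.truthful t t'
  rational h t := by
    rw [m.utility_mech hq]
    exact (m.optimal q hq).1.rational h t

theorem exAnte_mech (m : LPMechanism b) {q : J → ℝ} (hq : q ∈ Icc (0 : J → ℝ) 1) (j : J) :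
    b.exAnte (toMech (m.mech q)) j = ∑ t, b.prob t * m.alloc q t j := by
  simp only [Buyer.exAnte, m.measureReal_mem hq]

theorem exAnte_mech_le (m : LPMechanism b) {q : J → ℝ} (hq : q ∈ Icc (0 : J → ℝ) 1) (j : J) :
    b.exAnte (toMech (m.mech q)) j ≤ q j := by
  rw [m.exAnte_mech hq]
  exact (m.optimal q hq).1.cap j

theorem revenue_mech (m : LPMechanism b) {q : J → ℝ} (hq : q ∈ Icc (0 : J → ℝ) 1) :
    b.revenue (toMech (m.mech q)) = b.benchmark q := by
  rw [(m.optimal q hq).benchmark_eq]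
  refine Finset.sum_congr rfl fun t _ => ?_
  have : ∫ o, o.2 ∂(toMech (m.mech q) t) = ∫ _, m.pay q t ∂(toMech (m.mech q) t) :=
    integral_congr_ae (ae_toMeasure_of_support _ fun o ho => m.payment_of_mem_support t ho)
  rw [this]
  simp

theorem isOptimalUnderCap_mech (m : LPMechanism b) {q : J → ℝ} (hq : q ∈ Icc (0 : J → ℝ) 1) :
    b.IsOptimalUnderCap q (toMech (m.mech q)) :=
  ⟨m.isFeasible_mech hq, m.exAnte_mech_le hq, fun N' hN' hcap => by
    rw [m.revenue_mech hq]
    exact hN'.revenue_le_benchmark hq hcap⟩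

end LPMechanism

/-! ### The ex ante rule as an arithmetic expression, and the requirements of post-rounding -/

/-- The sum of products over a list of registers, as an expression. -/
def ArithExpr.sumMul {T : Type*} : List T → ArithExpr (T ⊕ T)
  | [] => .zero
  | t :: l => .add (.mul (.input (.inl t)) (.input (.inr t))) (sumMul l)

theorem ArithExpr.ops_sumMul {T : Type*} (l : List T) : (sumMul l).ops = 2 * l.length := by
  induction l with
  | nil => rfl
  | cons t l ih => simp only [sumMul, ops, ih, List.length_cons]; ring

theorem ArithExpr.eval_sumMul {T : Type*} (f g : T → ℝ) (l : List T) :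
    (sumMul l).eval (Sum.elim f g) = (l.map fun t => f t * g t).sum := by
  induction l with
  | nil => rfl
  | cons t l ih => simp [sumMul, eval, ih]

theorem LPMechanism.postRoundingRequirements {J : Type*} {T : Type*} [Fintype J] [DecidableEq J]
    [Fintype T] {b : Buyer J T} (m : LPMechanism b) :
    PostRoundingRequirements b (fun _ _ pay => pay) 1 b.benchmark m.mech m.alloc where
  concave := b.concaveOn_benchmark
  upper _ hq _ hN hcap := hN.revenue_le_benchmark hq hcap
  feasible _ hq := ⟨m.isFeasible_mech hq, m.exAnte_mech_le hq⟩
  approx q hq := by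
    rw [one_mul]
    exact (m.revenue_mech hq).ge
  exact_rule j := ⟨.sumMul Finset.univ.toList, by simp [ArithExpr.ops_sumMul], fun q hq => by
    rw [m.exAnte_mech hq, ArithExpr.eval_sumMul, Finset.sum_map_toList]⟩
  linear := ⟨1, zero_le_one, fun _ _ _ => by simp⟩
  cost_sharing _ := ⟨fun _ _ => 0, fun _ _ => le_rfl, fun _ => by simp, fun _ _ _ => le_rfl⟩
  valuations := b.isMatroidWeightedRank_value

/-! ### Optimal caps -/

/-- Maximizing jointly over caps and LP assignments is a continuous problem on a compact set, so no
continuity of the benchmarks up to the boundary of the cube is needed. -/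
theorem exists_capsOptimal {J : Type*} [Fintype J] {n : ℕ} {T : Fin n → Type*}
    [∀ i, Fintype (T i)] (b : ∀ i, Buyer J (T i)) (units : J → ℕ) :
    ∃ Q, CapsOptimal (fun i => (b i).benchmark) units Q := by
  have hc : IsCompact ((Set.univ.pi fun i => (b i).lpGraph) ∩
      {z | ∀ j, ∑ i, (z i).1 j ≤ units j}) := by
    refine (isCompact_univ_pi fun i => (b i).isCompact_lpGraph).inter_right ?_
    simp only [ofPred_forall]
    exact isClosed_iInter fun j => isClosed_le (by fun_prop) continuous_const
  obtain ⟨z, ⟨hz, hu⟩, hmax⟩ := hc.exists_isMaxOn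
    ⟨fun _ => (0, 0, 0), fun i _ => ⟨⟨le_rfl, zero_le_one⟩, (b i).lpFeasible_zero le_rfl⟩,
      fun j => by simp⟩
    (f := fun z => ∑ i, ∑ t, (b i).prob t * (z i).2.2 t) (by fun_prop)
  refine ⟨fun i => (z i).1, ⟨fun i => (hz i trivial).1, hu⟩, fun Q' hQ' => ?_⟩
  choose x p h using fun i => (b i).exists_lpOptimal (hQ'.1 i)
  calc ∑ i, (b i).benchmark (Q' i) = ∑ i, ∑ t, (b i).prob t * p i t :=
        Finset.sum_congr rfl fun i _ => (h i).benchmark_eq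
    _ ≤ ∑ i, ∑ t, (b i).prob t * (z i).2.2 t :=
        hmax (a := fun i => (Q' i, x i, p i)) ⟨fun i _ => ⟨hQ'.1 i, (h i).1⟩, hQ'.2⟩
    _ ≤ ∑ i, (b i).benchmark (z i).1 :=
        Finset.sum_le_sum fun i _ => (hz i trivial).2.le_benchmark (hz i trivial).1

/-! ### The conservative magician -/

/-- Distribution functions of numbers which are at most `m`. -/
structure IsCDF (m : ℕ) (F : ℕ → ℝ) : Prop where
  mono : Monotone F
  nonneg : ∀ w, 0 ≤ F w
  eq_one : ∀ w, m ≤ w → F w = 1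

theorem prev_mono_fun {F G : ℕ → ℝ} (h : ∀ w, F w ≤ G w) (w : ℕ) : prev F w ≤ prev G w := by
  cases w with
  | zero => exact le_rfl
  | succ w => exact h w

namespace IsCDF

variable {m : ℕ} {F : ℕ → ℝ}

theorem prev_le (h : IsCDF m F) (w : ℕ) : prev F w ≤ F w := by
  cases w with
  | zero => exact h.nonneg 0
  | succ w => exact h.mono w.le_succ

theorem prev_nonneg (h : IsCDF m F) (w : ℕ) : 0 ≤ prev F w := by
  cases w with
  | zero => exact le_rfl
  | succ w => exact h.nonneg w

theorem prev_monotone (h : IsCDF m F) : Monotone (prev F) :=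
  monotone_nat_of_le_succ fun w => h.prev_le w

theorem nonempty (h : IsCDF m F) {γ : ℝ} (hγ : γ ≤ 1) : {w | γ ≤ F w}.Nonempty :=
  ⟨m, by simpa [h.eq_one m le_rfl] using hγ⟩

theorem le_apply_thresholdOf (h : IsCDF m F) {γ : ℝ} (hγ : γ ≤ 1) : γ ≤ F (thresholdOf γ F) :=
  Nat.sInf_mem (h.nonempty hγ)

theorem apply_lt {γ : ℝ} {w : ℕ} (hw : w < thresholdOf γ F) : F w < γ :=
  not_le.1 (Nat.notMem_of_lt_sInf hw)

theorem prev_thresholdOf_le {γ : ℝ} (hγ : 0 ≤ γ) : prev F (thresholdOf γ F) ≤ γ := by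
  rcases h : thresholdOf γ F with _ | w
  · exact hγ
  · exact (apply_lt (by omega : w < thresholdOf γ F)).le

theorem thresholdOf_lt_iff (h : IsCDF m F) {γ : ℝ} (hγ : γ ≤ 1) {l : ℕ} (hl : 1 ≤ l) :
    thresholdOf γ F < l ↔ γ ≤ F (l - 1) := by
  constructor
  · exact fun hlt => (h.le_apply_thresholdOf hγ).trans (h.mono (by omega))
  · intro hle
    have : thresholdOf γ F ≤ l - 1 := Nat.sInf_le hle
    omega

theorem openProbOf_mem (h : IsCDF m F) {γ : ℝ} (hγ : γ ∈ Icc (0 : ℝ) 1) (w : ℕ) :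
    openProbOf γ F w ∈ Icc (0 : ℝ) 1 := by
  unfold openProbOf
  split_ifs with h1 h2
  · simp
  · subst h2
    have h3 := prev_thresholdOf_le (F := F) hγ.1
    have h4 := h.le_apply_thresholdOf hγ.2
    exact ⟨div_nonneg (by linarith) (by linarith), div_le_one_of_le₀ (by linarith) (by linarith)⟩
  · simp

/-- The probability of opening the box with `w` broken wands, as a truncation. -/
theorem openProbOf_mul (h : IsCDF m F) {γ : ℝ} (hγ : γ ∈ Icc (0 : ℝ) 1) (w : ℕ) :
    openProbOf γ F w * (F w - prev F w) = min (F w) γ - min (prev F w) γ := by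
  unfold openProbOf
  split_ifs with h1 h2
  · have := (apply_lt h1).le
    rw [min_eq_left this, min_eq_left ((h.prev_le w).trans this), one_mul]
  · subst h2
    have h3 := prev_thresholdOf_le (F := F) hγ.1
    have h4 := h.le_apply_thresholdOf hγ.2
    rw [min_eq_right h4, min_eq_left h3]
    -- If the denominator vanishes, the quotient is `0` by convention; the identity survives because
    -- `γ` then lies between two equal numbers.
    rcases eq_or_ne (F (thresholdOf γ F) - prev F (thresholdOf γ F)) 0 with h0 | h0
    · rw [h0]; linarith
    · rw [div_mul_cancel₀ _ h0]
  · have hlt : thresholdOf γ F < w := by omega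
    have h3 : γ ≤ prev F w := by
      obtain ⟨v, rfl⟩ := Nat.exists_eq_succ_of_ne_zero (by omega : w ≠ 0)
      exact (h.le_apply_thresholdOf hγ.2).trans (h.mono (by omega))
    rw [min_eq_right h3, min_eq_right (h3.trans (h.prev_le w))]
    ring

/-- The truncations telescope to `min (F m) γ`. This is why the magician opens each box with total
probability exactly `γ`. -/
theorem sum_openProbOf_mul (h : IsCDF m F) {γ : ℝ} (hγ : γ ∈ Icc (0 : ℝ) 1) :
    ∑ w ∈ Finset.range (m + 1), openProbOf γ F w * (F w - prev F w) = γ := by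
  have : ∀ N, ∑ w ∈ Finset.range (N + 1), openProbOf γ F w * (F w - prev F w) =
      min (F N) γ := by
    intro N
    induction N with
    | zero =>
      rw [zero_add, Finset.sum_range_one, h.openProbOf_mul hγ]
      simp [prev, hγ.1]
    | succ N ih =>
      rw [Finset.sum_range_succ, ih, h.openProbOf_mul hγ]
      simp [prev]
  rw [this, h.eq_one m le_rfl, min_eq_right hγ.2]

end IsCDF

/-! ### The truncated recursion: continuity and monotonicity in `γ` -/

/-- The recursion of the magician written with truncations instead of opening probabilities. -/
def truncCDF (γ : ℝ) (x : ℕ → ℝ) : ℕ → ℕ → ℝ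
  | 0 => fun _ => 1
  | i + 1 => fun w =>
      truncCDF γ x i w - x i * (min (truncCDF γ x i w) γ - min (prev (truncCDF γ x i) w) γ)

/-- The thresholds jump as `γ` varies and the opening probabilities are quotients, but the truncated
recursion is built from `min` and arithmetic only. Continuity makes the set of admissible `γ`
closed. -/
theorem continuous_truncCDF (x : ℕ → ℝ) (i w : ℕ) : Continuous fun γ => truncCDF γ x i w := by
  induction i generalizing w with
  | zero => exact continuous_const
  | succ i ih =>
    cases w with
    | zero =>
      simp only [truncCDF, prev]
      have := ih 0
      fun_prop
    | succ w =>
      simp only [truncCDF, prev]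
      have := ih w
      have := ih (w + 1)
      fun_prop

/-- Truncation at `γ` is non-decreasing and 1-Lipschitz, so subtracting a fraction `x ≤ 1` of it
keeps monotonicity. -/
theorem sub_mul_min_mono {x : ℝ} (hx : x ∈ Icc (0 : ℝ) 1) (γ : ℝ) {y z : ℝ} (h : y ≤ z) :
    y - x * min y γ ≤ z - x * min z γ := by
  have h1 : 0 ≤ min z γ - min y γ := sub_nonneg.2 (min_le_min_right γ h)
  have h2 : min z γ - min y γ ≤ z - y := by
    rcases le_total y γ with h3 | h3
    · rw [min_eq_left h3]; linarith [min_le_left z γ]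
    · rw [min_eq_right h3, min_eq_right (h3.trans h)]; linarith
  nlinarith [mul_le_of_le_one_left h1 hx.2]

theorem isCDF_truncCDF {γ : ℝ} (hγ : γ ∈ Icc (0 : ℝ) 1) {x : ℕ → ℝ}
    (hx : ∀ i, x i ∈ Icc (0 : ℝ) 1) (i : ℕ) : IsCDF i (truncCDF γ x i) := by
  induction i with
  | zero => exact ⟨fun _ _ _ => le_rfl, fun _ => zero_le_one, fun _ _ => rfl⟩
  | succ i ih =>
    refine ⟨fun v w hvw => ?_, fun w => ?_, fun w hw => ?_⟩
    · have h1 := sub_mul_min_mono (hx i) γ (ih.mono hvw)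
      have h2 := mul_le_mul_of_nonneg_left (min_le_min_right γ (ih.prev_monotone hvw)) (hx i).1
      simp only [truncCDF]
      linarith
    · have h1 := sub_mul_min_mono (hx i) γ (ih.nonneg w)
      have h2 : 0 ≤ x i * min (prev (truncCDF γ x i) w) γ :=
        mul_nonneg (hx i).1 (le_min (ih.prev_nonneg w) hγ.1)
      rw [min_eq_left hγ.1, mul_zero, sub_zero] at h1
      simp only [truncCDF]
      linarith
    · obtain ⟨v, rfl⟩ := Nat.exists_eq_succ_of_ne_zero (by omega : w ≠ 0)
      simp [truncCDF, prev, ih.eq_one v (by omega), ih.eq_one (v + 1) (by omega)]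

theorem brokenCDF_eq_truncCDF {γ : ℝ} (hγ : γ ∈ Icc (0 : ℝ) 1) {x : ℕ → ℝ}
    (hx : ∀ i, x i ∈ Icc (0 : ℝ) 1) (i : ℕ) : brokenCDF γ x i = truncCDF γ x i := by
  induction i with
  | zero => rfl
  | succ i ih =>
    funext w
    have := (isCDF_truncCDF hγ hx i).openProbOf_mul hγ w
    simp only [brokenCDF, truncCDF, ih, ← this]
    ring

theorem isCDF_brokenCDF {γ : ℝ} (hγ : γ ∈ Icc (0 : ℝ) 1) {x : ℕ → ℝ}
    (hx : ∀ i, x i ∈ Icc (0 : ℝ) 1) (i : ℕ) : IsCDF i (brokenCDF γ x i) := by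
  rw [brokenCDF_eq_truncCDF hγ hx]
  exact isCDF_truncCDF hγ hx i

/-- A bolder magician breaks stochastically more wands. One step compares the two distribution
functions at the same level `γ`, where the recursion is monotone in its input, and then raises the
level for a fixed distribution function. -/
theorem truncCDF_antitone {γ γ' : ℝ} (hγ' : γ' ∈ Icc (0 : ℝ) 1)
    (h : γ ≤ γ') {x : ℕ → ℝ} (hx : ∀ i, x i ∈ Icc (0 : ℝ) 1) (i w : ℕ) :
    truncCDF γ' x i w ≤ truncCDF γ x i w := by
  induction i generalizing w with
  | zero => exact le_rfl
  | succ i ih =>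
    have hF := isCDF_truncCDF hγ' hx i
    have h1 := sub_mul_min_mono (hx i) γ (ih w)
    have h2 := mul_le_mul_of_nonneg_left (min_le_min_right γ (prev_mono_fun ih w)) (hx i).1
    -- The part of the interval from `prev F w` to `F w` that lies below the level grows with the
    -- level.
    have h3 : min (truncCDF γ' x i w) γ - min (prev (truncCDF γ' x i) w) γ ≤
        min (truncCDF γ' x i w) γ' - min (prev (truncCDF γ' x i) w) γ' := by
      have h4 := hF.prev_le w
      rcases le_total (prev (truncCDF γ' x i) w) γ with h5 | h5
      · rw [min_eq_left h5, min_eq_left (h5.trans h)]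
        exact sub_le_sub_right (min_le_min_left _ h) _
      · rw [min_eq_right h5, min_eq_right (h5.trans h4), sub_self]
        exact sub_nonneg.2 (min_le_min_right γ' h4)
    have h4 := mul_le_mul_of_nonneg_left h3 (hx i).1
    simp only [truncCDF]
    linarith

/-- The values of `γ` for which the magician never runs out of wands form a closed interval. -/
theorem gammaConst_set_eq {k : ℕ} (hk : 1 ≤ k) :
    {γ : ℝ | γ ∈ Icc (0 : ℝ) 1 ∧ ∀ k' ≥ k, ∀ (m : ℕ) (x : ℕ → ℝ),
      (∀ i, x i ∈ Icc (0 : ℝ) 1) → ∑ i ∈ Finset.range m, x i ≤ k' →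
        ∀ i < m, threshold γ x i < k'} =
    {γ : ℝ | γ ∈ Icc (0 : ℝ) 1 ∧ ∀ k' ≥ k, ∀ (m : ℕ) (x : ℕ → ℝ),
      (∀ i, x i ∈ Icc (0 : ℝ) 1) → ∑ i ∈ Finset.range m, x i ≤ k' →
        ∀ i < m, γ ≤ truncCDF γ x i (k' - 1)} := by
  ext γ
  refine and_congr_right fun hγ => forall₂_congr fun k' hk' => forall₂_congr fun m x =>
    forall₂_congr fun hx _ => forall₂_congr fun i _ => ?_
  rw [threshold, brokenCDF_eq_truncCDF hγ hx]
  exact (isCDF_truncCDF hγ hx i).thresholdOf_lt_iff hγ.2 (hk.trans hk')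

/-- The admissible set contains `0`, is bounded and closed, so it contains its supremum; by
antitonicity of the distribution functions every smaller non-negative `γ` is admissible too. -/
theorem threshold_lt_of_le_gammaConst {k : ℕ} (hk : 1 ≤ k) {γ : ℝ}
    (hγ : γ ∈ Icc 0 (gammaConst k)) :
    γ ≤ 1 ∧ ∀ k' ≥ k, ∀ (m : ℕ) (x : ℕ → ℝ),
      (∀ i, x i ∈ Icc (0 : ℝ) 1) → ∑ i ∈ Finset.range m, x i ≤ k' →
        ∀ i < m, threshold γ x i < k' := by
  set A : Set ℝ := {γ : ℝ | γ ∈ Icc (0 : ℝ) 1 ∧ ∀ k' ≥ k, ∀ (m : ℕ) (x : ℕ → ℝ),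
      (∀ i, x i ∈ Icc (0 : ℝ) 1) → ∑ i ∈ Finset.range m, x i ≤ k' →
        ∀ i < m, γ ≤ truncCDF γ x i (k' - 1)} with hA
  have hsup : gammaConst k = sSup A := congrArg sSup (gammaConst_set_eq hk)
  have hbdd : BddAbove A := ⟨1, fun γ h => h.1.2⟩
  have hzero : (0 : ℝ) ∈ A := by
    have h0 : (0 : ℝ) ∈ Icc (0 : ℝ) 1 := by simp
    exact ⟨h0, fun k' _ m x hx _ i _ => (isCDF_truncCDF h0 hx i).nonneg _⟩
  have hclosed : IsClosed A := by
    simp only [hA, ofPred_and, ofPred_forall]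
    exact isClosed_Icc.inter (isClosed_iInter fun k' => isClosed_iInter fun _ =>
      isClosed_iInter fun m => isClosed_iInter fun x => isClosed_iInter fun _ =>
      isClosed_iInter fun _ => isClosed_iInter fun i => isClosed_iInter fun _ =>
      isClosed_le continuous_id (continuous_truncCDF x i _))
  have hmem := hclosed.csSup_mem ⟨0, hzero⟩ hbdd
  rw [← hsup] at hmem
  have hγ1 : γ ∈ Icc (0 : ℝ) 1 := ⟨hγ.1, hγ.2.trans hmem.1.2⟩
  have : γ ∈ A := ⟨hγ1, fun k' hk' m x hx hs i hi => hγ.2.trans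
    ((hmem.2 k' hk' m x hx hs i hi).trans (truncCDF_antitone hmem.1 hγ.2 hx i _))⟩
  rw [hA, ← gammaConst_set_eq hk] at this
  exact ⟨hγ1.2, this.2⟩

/-! ### Product priors -/

section Profiles

variable {J : Type*} {n : ℕ} {T : Fin n → Type*} [∀ i, Fintype (T i)]

theorem profileProb_nonneg (b : ∀ i, Buyer J (T i)) (t : ∀ i, T i) : 0 ≤ profileProb b t :=
  Finset.prod_nonneg fun i _ => (b i).prob_nonneg _

theorem sum_profileProb (b : ∀ i, Buyer J (T i)) : ∑ t, profileProb b t = 1 := by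
  have := Fintype.prod_sum fun i => (b i).prob
  simp only [Buyer.prob_sum, Finset.prod_const_one] at this
  exact this.symm

/-- Exchanging `t i` with an independent copy `r` preserves the product law. The product form avoids
dividing by probabilities that may vanish. -/
theorem profileProb_update_mul (b : ∀ i, Buyer J (T i)) (t : ∀ i, T i) (i : Fin n) (r : T i) :
    profileProb b (Function.update t i r) * (b i).prob (t i) =
      profileProb b t * (b i).prob r := by
  unfold profileProb
  rw [← Finset.mul_prod_erase _ _ (Finset.mem_univ i),
    ← Finset.mul_prod_erase _ (fun l => (b l).prob (t l)) (Finset.mem_univ i)]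
  have : ∏ l ∈ Finset.univ.erase i, (b l).prob (Function.update t i r l) =
      ∏ l ∈ Finset.univ.erase i, (b l).prob (t l) :=
    Finset.prod_congr rfl fun l hl => by rw [Function.update_of_ne (Finset.ne_of_mem_erase hl)]
  rw [this, Function.update_self]
  ring

/-- Redrawing one type from its prior does not change the law of the type profile. -/
theorem sum_profileProb_resample (b : ∀ i, Buyer J (T i)) (i : Fin n) (G : (∀ i, T i) → ℝ) :
    ∑ t, profileProb b t * ∑ r, (b i).prob r * G (Function.update t i r) =
      ∑ t, profileProb b t * G t := by
  let e : ((∀ i, T i) × T i) ≃ ((∀ i, T i) × T i) :=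
    Function.Involutive.toPerm (fun z => (Function.update z.1 i z.2, z.1 i)) fun z => by simp
  calc ∑ t, profileProb b t * ∑ r, (b i).prob r * G (Function.update t i r)
      = ∑ z : (∀ i, T i) × T i,
          profileProb b z.1 * ((b i).prob z.2 * G (Function.update z.1 i z.2)) := by
        simp only [Fintype.sum_prod_type, Finset.mul_sum]
    _ = ∑ z : (∀ i, T i) × T i, profileProb b z.1 * ((b i).prob z.2 * G z.1) := by
        refine Fintype.sum_equiv e _ _ fun z => ?_
        change _ = profileProb b (Function.update z.1 i z.2) *
          ((b i).prob (z.1 i) * G (Function.update z.1 i z.2))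
        rw [← mul_assoc, ← mul_assoc, profileProb_update_mul]
    _ = ∑ t, profileProb b t * G t := by
        rw [Fintype.sum_prod_type]
        refine Finset.sum_congr rfl fun t _ => ?_
        dsimp only
        rw [← Finset.mul_sum, ← Finset.sum_mul, (b i).prob_sum, one_mul]

/-- Independence of the coordinates: `g` ignores coordinate `i` and `h` sees nothing else. -/
theorem sum_profileProb_mul_of_indep (b : ∀ i, Buyer J (T i)) (i : Fin n) (g : (∀ i, T i) → ℝ)
    (hg : ∀ t r, g (Function.update t i r) = g t) (h : T i → ℝ) :
    ∑ t, profileProb b t * (g t * h (t i)) =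
      (∑ t, profileProb b t * g t) * ∑ r, (b i).prob r * h r := by
  rw [← sum_profileProb_resample b i]
  simp only [hg, Function.update_self, Finset.sum_mul]
  refine Finset.sum_congr rfl fun t _ => ?_
  rw [mul_assoc, Finset.mul_sum _ _ (g t)]
  congr 1
  exact Finset.sum_congr rfl fun r _ => by ring

theorem sum_profileProb_coord (b : ∀ i, Buyer J (T i)) (i : Fin n) (h : T i → ℝ) :
    ∑ t, profileProb b t * h (t i) = ∑ r, (b i).prob r * h r := by
  have := sum_profileProb_mul_of_indep b i (fun _ => 1) (fun _ _ => rfl) h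
  simpa [sum_profileProb] using this

/-! ### Induced mechanisms -/

variable (b : ∀ i, Buyer J (T i)) (M : (∀ i, T i) → Measure (Fin n → Finset J × ℝ))

theorem measureReal_induced [hM : ∀ t, IsProbabilityMeasure (M t)] (i : Fin n) (r : T i)
    {s : Set (Finset J × ℝ)} (hs : MeasurableSet s) :
    (induced b M i r).real s =
      ∑ t, profileProb b t * (M (Function.update t i r)).real {o | o i ∈ s} := by
  unfold induced
  rw [measureReal_def, Measure.finsetSum_apply, ENNReal.toReal_sum]
  · refine Finset.sum_congr rfl fun t _ => ?_
    rw [Measure.smul_apply, smul_eq_mul, ENNReal.toReal_mul,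
      ENNReal.toReal_ofReal (profileProb_nonneg b t), Measure.map_apply (measurable_pi_apply i) hs]
    rfl
  · intro t _
    rw [Measure.smul_apply, Measure.map_apply (measurable_pi_apply i) hs]
    exact ENNReal.mul_ne_top ENNReal.ofReal_ne_top (measure_ne_top _ _)

theorem isFiniteMeasure_induced [hM : ∀ t, IsProbabilityMeasure (M t)] (i : Fin n) (r : T i) :
    IsFiniteMeasure (induced b M i r) := by
  refine ⟨?_⟩
  unfold induced
  rw [Measure.finsetSum_apply]
  refine ENNReal.sum_lt_top.2 fun t _ => ?_
  rw [Measure.smul_apply, Measure.map_apply (measurable_pi_apply i) MeasurableSet.univ]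
  exact ENNReal.mul_lt_top ENNReal.ofReal_lt_top (measure_lt_top _ _)

theorem isProbabilityMeasure_induced [hM : ∀ t, IsProbabilityMeasure (M t)] (i : Fin n) (r : T i) :
    IsProbabilityMeasure (induced b M i r) := by
  have := isFiniteMeasure_induced b M i r
  have h := measureReal_induced b M i r MeasurableSet.univ
  simp only [mem_univ, ofPred_true, probReal_univ, mul_one, sum_profileProb] at h
  refine ⟨?_⟩
  rw [measureReal_def] at h
  rw [← ENNReal.toReal_eq_one_iff]
  exact h

theorem ae_induced (i : Fin n) (r : T i) {P : Finset J × ℝ → Prop} (hP : MeasurableSet {o | P o})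
    (h : ∀ t, ∀ᵐ o ∂(M (Function.update t i r)), P (o i)) : ∀ᵐ o ∂(induced b M i r), P o := by
  rw [ae_iff]
  unfold induced
  rw [Measure.finsetSum_apply]
  refine Finset.sum_eq_zero fun t _ => ?_
  rw [Measure.smul_apply, Measure.map_apply (measurable_pi_apply i) hP.compl, smul_eq_mul]
  exact mul_eq_zero_of_right _ (ae_iff.1 (h t))

theorem integral_payment_induced [hM : ∀ t, IsProbabilityMeasure (M t)] (i : Fin n) (r : T i)
    {B : ℝ} (h : ∀ᵐ o ∂(induced b M i r), o.2 ∈ Icc 0 B) :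
    ∫ o, o.2 ∂(induced b M i r) =
      ∑ t, profileProb b t * ∫ o, (o i).2 ∂(M (Function.update t i r)) := by
  have := isFiniteMeasure_induced b M i r
  have hint : ∀ t ∈ Finset.univ, Integrable (fun o : Finset J × ℝ => o.2)
      (ENNReal.ofReal (profileProb b t) •
        (M (Function.update t i r)).map fun o => o i) := fun t ht =>
    -- Each weighted summand is dominated by the induced law and inherits integrability from it.
    -- This needs no payment bound on profiles of probability zero.
    (integrable_payment h).mono_measure (Measure.le_iff.2 fun s _ => by
      unfold induced
      rw [Measure.finsetSum_apply]
      exact Finset.single_le_sum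
        (f := fun t => (ENNReal.ofReal (profileProb b t) •
          (M (Function.update t i r)).map fun o => o i) s) (fun _ _ => zero_le) ht)
  unfold induced
  rw [integral_finsetSum_measure hint]
  refine Finset.sum_congr rfl fun t _ => ?_
  rw [integral_smul_measure, ENNReal.toReal_ofReal (profileProb_nonneg b t), smul_eq_mul,
    integral_map (measurable_pi_apply i).aemeasurable measurable_snd.aestronglyMeasurable]

variable {b M}

/-- A report drawn from the prior, put in place of the drawn type, again gives a profile with the
product law. -/
theorem IsFeasibleMulti.multiRevenue_eq [DecidableEq J] {units : J → ℕ}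
    (h : IsFeasibleMulti b units M) :
    multiRevenue b M = ∑ i, (b i).revenue (induced b M i) := by
  have hM := h.isProb
  refine Finset.sum_congr rfl fun i _ => ?_
  rw [← sum_profileProb_resample b i]
  simp only [Finset.mul_sum, Buyer.revenue, Buyer.expected,
    integral_payment_induced b M i _ ((h.single i).payment _)]
  rw [Finset.sum_comm]
  exact Finset.sum_congr rfl fun r _ => Finset.sum_congr rfl fun t _ => by ring

theorem exAnte_induced [Fintype J] [hM : ∀ t, IsProbabilityMeasure (M t)] (i : Fin n) (j : J) :
    (b i).exAnte (induced b M i) j = ∑ t, profileProb b t * (M t).real {o | j ∈ (o i).1} := by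
  have hm : MeasurableSet {o : Finset J × ℝ | j ∈ o.1} :=
    measurable_fst (MeasurableSet.of_discrete (s := {S : Finset J | j ∈ S}))
  rw [← sum_profileProb_resample b i]
  simp only [Buyer.exAnte, measureReal_induced b M i _ hm, Finset.mul_sum, mem_ofPred_eq]
  rw [Finset.sum_comm]
  exact Finset.sum_congr rfl fun r _ => Finset.sum_congr rfl fun t _ => by ring

/-- Expected numbers of allocated units respect the supply. -/
theorem IsFeasibleMulti.sum_exAnte_le [Fintype J] [DecidableEq J] {units : J → ℕ}
    (h : IsFeasibleMulti b units M) (j : J) :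
    ∑ i, (b i).exAnte (induced b M i) j ≤ units j := by
  have hM := h.isProb
  simp only [exAnte_induced]
  rw [Finset.sum_comm]
  simp only [← Finset.mul_sum]
  have hm : ∀ i, MeasurableSet {o : Fin n → Finset J × ℝ | j ∈ (o i).1} := fun i =>
    (measurable_fst.comp (measurable_pi_apply i))
      (MeasurableSet.of_discrete (s := {S : Finset J | j ∈ S}))
  have hle : ∀ t, ∑ i, (M t).real {o | j ∈ (o i).1} ≤ units j := fun t => by
    have hint : ∀ i, Integrable ({o : Fin n → Finset J × ℝ | j ∈ (o i).1}.indicator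
        (1 : (Fin n → Finset J × ℝ) → ℝ)) (M t) := fun i =>
      (integrable_const (1 : ℝ)).indicator (hm i)
    have : ∑ i, (M t).real {o | j ∈ (o i).1} =
        ∫ o, ∑ i, {o : Fin n → Finset J × ℝ | j ∈ (o i).1}.indicator
          (1 : (Fin n → Finset J × ℝ) → ℝ) o ∂(M t) := by
      rw [integral_finsetSum _ fun i _ => hint i]
      exact Finset.sum_congr rfl fun i _ => (integral_indicator_one (hm i)).symm
    rw [this]
    refine (integral_mono_ae (integrable_finsetSum _ fun i _ => hint i)
      (integrable_const (units j : ℝ)) ?_).trans_eq (by simp)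
    filter_upwards [h.supply t j] with o ho
    simp only [Set.indicator, mem_ofPred_eq, Pi.one_apply, Finset.sum_boole]
    exact_mod_cast ho
  calc ∑ t, profileProb b t * ∑ i, (M t).real {o | j ∈ (o i).1}
      ≤ ∑ t, profileProb b t * units j := Finset.sum_le_sum fun t _ =>
        mul_le_mul_of_nonneg_left (hle t) (profileProb_nonneg b t)
    _ = units j := by rw [← Finset.sum_mul, sum_profileProb, one_mul]

theorem exAnte_mem {T : Type*} [Fintype T] (b : Buyer J T) (N : T → Measure (Finset J × ℝ))
    [hN : ∀ t, IsProbabilityMeasure (N t)] (j : J) : b.exAnte N j ∈ Icc (0 : ℝ) 1 := by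
  refine ⟨Finset.sum_nonneg fun t _ => mul_nonneg (b.prob_nonneg t) measureReal_nonneg, ?_⟩
  rw [← b.prob_sum]
  exact Finset.sum_le_sum fun t _ => mul_le_of_le_one_right (b.prob_nonneg t) measureReal_le_one

/-- The benchmark with optimal caps bounds the revenue of every feasible mechanism. -/
theorem IsFeasibleMulti.multiRevenue_le [Fintype J] [DecidableEq J] {units : J → ℕ}
    (h : IsFeasibleMulti b units M) {Q : Fin n → J → ℝ}
    (hQ : CapsOptimal (fun i => (b i).benchmark) units Q) :
    multiRevenue b M ≤ ∑ i, (b i).benchmark (Q i) := by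
  have hP := fun i => (h.single i).isProb
  have hmem : ∀ i, (b i).exAnte (induced b M i) ∈ Icc (0 : J → ℝ) 1 := fun i =>
    ⟨fun j => (exAnte_mem (b i) _ j).1, fun j => (exAnte_mem (b i) _ j).2⟩
  rw [h.multiRevenue_eq]
  -- The ex ante probabilities of the mechanism itself compete as caps against the optimal `Q`.
  exact (Finset.sum_le_sum fun i _ =>
    (h.single i).revenue_le_benchmark (hmem i) fun j => le_rfl).trans
    (hQ.2 (fun i => (b i).exAnte (induced b M i)) ⟨hmem, h.sum_exAnte_le⟩)

end Profiles

/-! ### Expectations of non-negative functions under discrete laws -/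

section Mean

variable {α β : Type*}

/-- Expectation of a non-negative function under a discrete law. -/
def mean (p : PMF α) (f : α → ℝ≥0∞) : ℝ≥0∞ := ∑' a, p a * f a

open Classical in
/-- Probability of an event under a discrete law. -/
def eventProb (p : PMF α) (P : α → Prop) : ℝ≥0∞ := mean p fun a => if P a then 1 else 0

theorem eventProb_eq_mean (p : PMF α) (P : α → Prop) [DecidablePred P] :
    eventProb p P = mean p fun a => if P a then 1 else 0 := by
  unfold eventProb
  congr!

theorem mean_pure (a : α) (f : α → ℝ≥0∞) : mean (PMF.pure a) f = f a := by
  rw [mean, tsum_eq_single a fun b hb => by simp [PMF.pure_apply, hb]]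
  simp

/-- Tonelli; with values in `ℝ≥0∞` no summability has to be checked. -/
theorem mean_bind (p : PMF α) (q : α → PMF β) (f : β → ℝ≥0∞) :
    mean (p.bind q) f = mean p fun a => mean (q a) f := by
  simp only [mean, PMF.bind_apply, ← ENNReal.tsum_mul_right, ← ENNReal.tsum_mul_left, mul_assoc]
  rw [ENNReal.tsum_comm]

theorem mean_map (p : PMF α) (g : α → β) (f : β → ℝ≥0∞) :
    mean (p.map g) f = mean p (f ∘ g) := by
  rw [PMF.map, mean_bind]
  simp only [Function.comp_apply, mean_pure]
  rfl

theorem mean_const (p : PMF α) (c : ℝ≥0∞) : mean p (fun _ => c) = c := by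
  rw [mean, ENNReal.tsum_mul_right, p.tsum_coe, one_mul]

theorem mean_add (p : PMF α) (f g : α → ℝ≥0∞) :
    mean p (fun a => f a + g a) = mean p f + mean p g := by
  simp only [mean, mul_add, ENNReal.tsum_add]

theorem mean_mul_const (p : PMF α) (f : α → ℝ≥0∞) (c : ℝ≥0∞) :
    mean p (fun a => f a * c) = mean p f * c := by
  simp only [mean, ← mul_assoc, ENNReal.tsum_mul_right]

theorem mean_sum {ι : Type*} (p : PMF α) (s : Finset ι) (f : ι → α → ℝ≥0∞) :
    mean p (fun a => ∑ i ∈ s, f i a) = ∑ i ∈ s, mean p (f i) := by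
  simp only [mean, Finset.mul_sum]
  exact Summable.tsum_finsetSum fun _ _ => ENNReal.summable

theorem mean_congr {p : PMF α} {f g : α → ℝ≥0∞} (h : ∀ a ∈ p.support, f a = g a) :
    mean p f = mean p g := by
  refine tsum_congr fun a => ?_
  by_cases ha : a ∈ p.support
  · rw [h a ha]
  · simp [(p.apply_eq_zero_iff a).2 ha]

theorem eventProb_add_not (p : PMF α) (P : α → Prop) :
    eventProb p P + eventProb p (fun a => ¬ P a) = 1 := by
  classical
  rw [eventProb, eventProb, ← mean_add]
  refine (mean_congr fun a _ => ?_).trans (mean_const p 1)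
  by_cases h : P a <;> simp [h]

theorem eventProb_le_one (p : PMF α) (P : α → Prop) : eventProb p P ≤ 1 := by
  rw [← eventProb_add_not p P]
  exact le_self_add

theorem eventProb_ne_top (p : PMF α) (P : α → Prop) : eventProb p P ≠ ∞ :=
  ((eventProb_le_one p P).trans_lt ENNReal.one_lt_top).ne

theorem mean_ite (p : PMF α) (P : α → Prop) [DecidablePred P] (u v : ℝ≥0∞) :
    mean p (fun a => if P a then u else v) = eventProb p P * u + (1 - eventProb p P) * v := by
  classical
  have h : 1 - eventProb p P = eventProb p fun a => ¬ P a :=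
    ENNReal.sub_eq_of_eq_add' ENNReal.one_ne_top
      ((add_comm _ _).trans (eventProb_add_not p P)).symm
  rw [h, eventProb, eventProb, ← mean_mul_const, ← mean_mul_const, ← mean_add]
  congr 1
  funext a
  by_cases h : P a <;> simp [h]

theorem measureReal_toMeasure [MeasurableSpace α] (p : PMF α) {s : Set α}
    (hs : MeasurableSet s) : p.toMeasure.real s = (eventProb p (· ∈ s)).toReal := by
  classical
  rw [measureReal_def, PMF.toMeasure_apply p hs]
  congr 1
  refine tsum_congr fun a => ?_
  by_cases h : a ∈ s <;> simp [h]

end Mean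

/-! ### Independent random subsets -/

section IndependentSubset

variable {J : Type*} [Fintype J] [DecidableEq J]

theorem eventProb_independentSubset (p : J → ℝ) (j : J) (hp : p j ≤ 1) :
    eventProb (independentSubset p) (j ∈ ·) = ENNReal.ofReal (p j) := by
  classical
  set f : J → ℝ≥0∞ := fun i => min (ENNReal.ofReal (p i)) 1 with hf
  have hfj : f j = ENNReal.ofReal (p j) :=
    min_eq_left (by rw [← ENNReal.ofReal_one]; exact ENNReal.ofReal_le_ofReal hp)
  rw [← hfj]
  -- With the complementary factor at `j` set to `0`, expanding the product keeps exactly the sets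
  -- containing `j`, while each factor other than that of `j` sums to `1`.
  have h := Fintype.prod_add f (Function.update (fun i => 1 - f i) j 0)
  rw [← Finset.mul_prod_erase _ _ (Finset.mem_univ j)] at h
  have h1 : ∏ i ∈ Finset.univ.erase j, (f i + Function.update (fun i => 1 - f i) j 0 i) = 1 :=
    Finset.prod_eq_one fun i hi => by
      rw [Function.update_of_ne (Finset.ne_of_mem_erase hi)]
      exact add_tsub_cancel_of_le (min_le_right _ _)
  rw [h1, Function.update_self, add_zero, mul_one] at h
  rw [h, eventProb, mean, tsum_fintype]
  refine Finset.sum_congr rfl fun S _ => ?_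
  have hS : independentSubset p S = (∏ i ∈ S, f i) * ∏ i ∈ Sᶜ, (1 - f i) := rfl
  by_cases hj : j ∈ S
  · rw [hS, if_pos hj, mul_one]
    congr 1
    refine Finset.prod_congr rfl fun i hi => ?_
    rw [Function.update_of_ne]
    rintro rfl
    exact Finset.mem_compl.1 hi hj
  · rw [if_neg hj, mul_zero, Finset.prod_eq_zero (Finset.mem_compl.2 hj)
      (Function.update_self _ _ _), mul_zero]

theorem pos_of_mem_support_independentSubset {p : J → ℝ} {S : Finset J}
    (hS : S ∈ (independentSubset p).support) {j : J} (hj : j ∈ S) : 0 < p j := by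
  by_contra h
  refine (PMF.mem_support_iff _ _).1 hS ?_
  change (∏ j ∈ S, min (ENNReal.ofReal (p j)) 1) * _ = 0
  rw [Finset.prod_eq_zero hj (by rw [ENNReal.ofReal_of_nonpos (not_lt.1 h)]; simp), zero_mul]

end IndependentSubset

/-! ### The run of post-rounding -/

section Run

variable {J : Type*} [Fintype J] [DecidableEq J] {n : ℕ} {T : Fin n → Type*} [∀ i, Fintype (T i)]

omit [Fintype J] in
/-- The number of wands of item `j` which are broken when the first `m` buyers are processed. -/
def brokenCount (j : J) (m : ℕ) (o : Fin n → Finset J × ℝ) : ℕ :=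
  (Finset.univ.filter fun l : Fin n => l.val < m ∧ j ∈ (o l).1).card

omit [Fintype J] in
theorem brokenCount_le (j : J) (m : ℕ) (o : Fin n → Finset J × ℝ) : brokenCount j m o ≤ m := by
  have : (Finset.univ.filter fun l : Fin n => l.val < m ∧ j ∈ (o l).1).map Fin.valEmbedding ⊆
      Finset.range m := by
    intro l hl
    simp only [Finset.mem_map, Finset.mem_filter] at hl
    obtain ⟨a, ha, rfl⟩ := hl
    simpa using ha.2.1
  simpa [brokenCount] using Finset.card_le_card this

omit [Fintype J] in
theorem brokenCount_succ_update (j : J) (i : Fin n) (o : Fin n → Finset J × ℝ)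
    (c : Finset J × ℝ) :
    brokenCount j (i + 1) (Function.update o i c) =
      brokenCount j i o + if j ∈ c.1 then 1 else 0 := by
  unfold brokenCount
  have : (Finset.univ.filter fun l : Fin n => l.val < i + 1 ∧ j ∈ (Function.update o i c l).1) =
      (Finset.univ.filter fun l : Fin n => l.val < i ∧ j ∈ (o l).1) ∪
        if j ∈ c.1 then {i} else ∅ := by
    ext l
    by_cases hl : l = i
    · subst hl
      by_cases hj : j ∈ c.1 <;> simp [hj]
    · have : l.val ≠ i.val := fun h => hl (Fin.ext h)
      have h2 : l.val < i + 1 ↔ l.val < i := by omega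
      by_cases hj : j ∈ c.1 <;> simp [hj, hl, h2, -Order.lt_add_one_iff]
  rw [this, Finset.card_union_of_disjoint]
  · split_ifs <;> simp
  · split_ifs <;> simp

variable (b : ∀ i, Buyer J (T i)) (D : ∀ i, T i → PMF (Finset J × ℝ)) (γ : ℝ)

/-- The probability that the magician of item `j` opens the next box after outcomes `o`. -/
def opening (j : J) (m : ℕ) (o : Fin n → Finset J × ℝ) : ℝ :=
  openProb γ (boxes b D j) m (brokenCount j m o)

theorem postStep_eq (t : ∀ i, T i) (i : Fin n) (o : Fin n → Finset J × ℝ) :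
    postStep b D γ t i o = (D i (t i)).bind fun c =>
      (independentSubset fun j => opening b D γ j i o).map fun S =>
        Function.update o i (S ∩ c.1, γ * c.2) := rfl

theorem postRun_succ (t : ∀ i, T i) (i : Fin n) :
    postRun b D γ t (i + 1) = (postRun b D γ t i).bind (postStep b D γ t i) := by
  simp [postRun]

/-- The run before buyer `i` reads only the types of earlier buyers. This supplies the independence
used when averaging over types. -/
theorem postRun_update (t : ∀ i, T i) (i : Fin n) (r : T i) (m : ℕ) (hm : m ≤ i) :
    postRun b D γ (Function.update t i r) m = postRun b D γ t m := by
  induction m with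
  | zero => rfl
  | succ m ih =>
    have hmn : m < n := by omega
    have hne : (⟨m, hmn⟩ : Fin n) ≠ i := fun h => by rw [← h] at hm; simp at hm
    have h1 := postRun_succ b D γ (Function.update t i r) ⟨m, hmn⟩
    have h2 := postRun_succ b D γ t ⟨m, hmn⟩
    simp only at h1 h2
    rw [h1, h2, ih (by omega)]
    congr 1
    funext o
    rw [postStep, postStep, Function.update_of_ne hne]

theorem mem_support_postStep {t : ∀ i, T i} {i : Fin n} {o o' : Fin n → Finset J × ℝ}
    (h : o' ∈ (postStep b D γ t i o).support) :
    ∃ c ∈ (D i (t i)).support, ∃ S : Finset J, (∀ j ∈ S, 0 < opening b D γ j i o) ∧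
      o' = Function.update o i (S ∩ c.1, γ * c.2) := by
  rw [postStep_eq, PMF.mem_support_bind_iff] at h
  obtain ⟨c, hc, h⟩ := h
  rw [PMF.mem_support_map_iff] at h
  obtain ⟨S, hS, rfl⟩ := h
  exact ⟨c, hc, S, fun j hj => pos_of_mem_support_independentSubset hS hj, rfl⟩

/-- Final outcomes are parts of tentative bundles with scaled tentative payments. -/
theorem exists_tentative_of_mem_support {t : ∀ i, T i} {m : ℕ} (hm : m ≤ n)
    {o : Fin n → Finset J × ℝ} (h : o ∈ (postRun b D γ t m).support) (i : Fin n) (hi : i.val < m) :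
    ∃ c ∈ (D i (t i)).support, (o i).1 ⊆ c.1 ∧ (o i).2 = γ * c.2 := by
  induction m generalizing o with
  | zero => omega
  | succ m ih =>
    have hrun := postRun_succ b D γ t ⟨m, hm⟩
    simp only at hrun
    rw [hrun, PMF.mem_support_bind_iff] at h
    obtain ⟨o', ho', h⟩ := h
    obtain ⟨c, hc, S, -, rfl⟩ := mem_support_postStep b D γ h
    rcases eq_or_ne i ⟨m, hm⟩ with rfl | hne
    · exact ⟨c, hc, by simp, by simp⟩
    · rw [Function.update_of_ne hne]
      exact ih (by omega) ho' (by
        have : i.val ≠ m := fun h => hne (Fin.ext h)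
        omega)

theorem openProb_eq_zero {x : ℕ → ℝ} {i w : ℕ} (h : threshold γ x i < w) :
    openProb γ x i w = 0 := by
  unfold openProb openProbOf
  rw [threshold] at h
  rw [if_neg (by omega), if_neg (by omega)]

/-- A wand is broken only if the box had positive opening probability, hence only at a count at most
the threshold; as the threshold is below `u`, one more wand still fits. -/
theorem brokenCount_le_of_mem_support {t : ∀ i, T i} {u : ℕ} (j : J)
    (hu : ∀ i < n, threshold γ (boxes b D j) i < u) {m : ℕ} (hm : m ≤ n)
    {o : Fin n → Finset J × ℝ} (h : o ∈ (postRun b D γ t m).support) :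
    brokenCount j m o ≤ u := by
  induction m generalizing o with
  | zero => simp [brokenCount]
  | succ m ih =>
    have hrun := postRun_succ b D γ t ⟨m, hm⟩
    simp only at hrun
    rw [hrun, PMF.mem_support_bind_iff] at h
    obtain ⟨o', ho', h⟩ := h
    obtain ⟨c, hc, S, hS, rfl⟩ := mem_support_postStep b D γ h
    have hcount := brokenCount_succ_update j ⟨m, hm⟩ o' (S ∩ c.1, γ * c.2)
    simp only at hcount
    rw [hcount]
    have hle := ih (by omega) ho'
    split_ifs with hj
    · have hpos := hS j (Finset.mem_inter.1 hj).1
      have hthr := hu m hm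
      by_contra hcon
      refine hpos.ne' (openProb_eq_zero γ ?_)
      change threshold γ (boxes b D j) m < brokenCount j m o'
      omega
    · simpa using hle

/-! ### Laws of broken wands -/

/-- Probability that the single buyer mechanism of buyer `i` allocates item `j` to type `r`. -/
def allocProb (i : Fin n) (r : T i) (j : J) : ℝ := (eventProb (D i r) (j ∈ ·.1)).toReal

omit [DecidableEq J] [∀ i, Fintype (T i)] in
theorem allocProb_eq (i : Fin n) (r : T i) (j : J) :
    allocProb D i r j = (toMech (D i) r).real {o | j ∈ o.1} := by
  rw [toMech, measureReal_toMeasure]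
  · rfl
  · exact measurable_fst (MeasurableSet.of_discrete (s := {S : Finset J | j ∈ S}))

omit [DecidableEq J] in
theorem boxes_eq (j : J) (i : Fin n) :
    boxes b D j i = ∑ r, (b i).prob r * allocProb D i r j := by
  simp [boxes, Buyer.exAnte, allocProb_eq]

omit [Fintype J] [DecidableEq J] in
theorem boxes_mem (j : J) (i : ℕ) : boxes b D j i ∈ Icc (0 : ℝ) 1 := by
  unfold boxes
  split_ifs with h
  · exact exAnte_mem _ _ j
  · simp

/-- Probability that `w` wands of item `j` are broken when `m` buyers are processed. -/
def countProb (j : J) (t : ∀ i, T i) (m w : ℕ) : ℝ :=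
  (eventProb (postRun b D γ t m) fun o => brokenCount j m o = w).toReal

variable {γ}

omit [Fintype J] in
theorem opening_mem (hγ : γ ∈ Icc (0 : ℝ) 1) (j : J) (m : ℕ) (o : Fin n → Finset J × ℝ) :
    opening b D γ j m o ∈ Icc (0 : ℝ) 1 :=
  (isCDF_brokenCDF hγ (boxes_mem b D j) m).openProbOf_mem hγ _

/-- Expectation over one step of a function of whether the buyer receives item `j`. -/
theorem mean_postStep (hγ : γ ∈ Icc (0 : ℝ) 1) (j : J) (t : ∀ i, T i) (i : Fin n)
    (o : Fin n → Finset J × ℝ) (f : (Fin n → Finset J × ℝ) → ℝ≥0∞) (u v : ℝ≥0∞)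
    (hf : ∀ c : Finset J × ℝ, f (Function.update o i c) = if j ∈ c.1 then u else v) :
    mean (postStep b D γ t i o) f =
      ENNReal.ofReal (allocProb D i (t i) j * opening b D γ j i o) * u +
        ENNReal.ofReal (1 - allocProb D i (t i) j * opening b D γ j i o) * v := by
  have hs := opening_mem b D hγ j i o
  set s := opening b D γ j i o with hsdef
  have hy0 : 0 ≤ allocProb D i (t i) j := ENNReal.toReal_nonneg
  have hy : eventProb (D i (t i)) (j ∈ ·.1) = ENNReal.ofReal (allocProb D i (t i) j) :=
    (ENNReal.ofReal_toReal (eventProb_ne_top _ _)).symm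
  have hy1 : allocProb D i (t i) j ≤ 1 := by
    rw [← ENNReal.ofReal_le_one, ← hy]; exact eventProb_le_one _ _
  set y := allocProb D i (t i) j
  have hsy : y * s ≤ 1 := mul_le_one₀ hy1 hs.1 hs.2
  have hsub : ∀ z : ℝ, 0 ≤ z → 1 - ENNReal.ofReal z = ENNReal.ofReal (1 - z) := fun z hz => by
    rw [ENNReal.ofReal_sub _ hz, ENNReal.ofReal_one]
  have hinner : ∀ c : Finset J × ℝ,
      mean ((independentSubset fun j => opening b D γ j i o).map fun S =>
        Function.update o i (S ∩ c.1, γ * c.2)) f =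
      if j ∈ c.1 then ENNReal.ofReal s * u + ENNReal.ofReal (1 - s) * v else v := fun c => by
    rw [mean_map]
    by_cases hj : j ∈ c.1
    · have : (f ∘ fun S => Function.update o i (S ∩ c.1, γ * c.2)) =
          fun S => if j ∈ S then u else v := by
        funext S; simp [hf, hj]
      rw [this, mean_ite, eventProb_independentSubset (fun j => opening b D γ j i o) j hs.2,
        if_pos hj, ← hsdef, hsub s hs.1]
    · have : (f ∘ fun S => Function.update o i (S ∩ c.1, γ * c.2)) = fun S => v := by
        funext S; simp [hf, hj]
      rw [this, mean_const, if_neg hj]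
  rw [postStep_eq, mean_bind]
  simp only [hinner]
  rw [mean_ite, hy, hsub y hy0, mul_add, ← mul_assoc, ← mul_assoc, ← ENNReal.ofReal_mul hy0,
    ← ENNReal.ofReal_mul hy0, add_assoc, ← add_mul, ← ENNReal.ofReal_add
      (mul_nonneg hy0 (by linarith [hs.2])) (by linarith)]
  have : y * (1 - s) + (1 - y) = 1 - y * s := by ring
  rw [this]

theorem countProb_zero (j : J) (t : ∀ i, T i) (w : ℕ) :
    countProb b D γ j t 0 w = if w = 0 then 1 else 0 := by
  classical
  simp only [countProb, eventProb, postRun, mean_pure, brokenCount]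
  by_cases h : w = 0
  · simp [h]
  · simp [h, Ne.symm h]

/-- One step of a pure birth chain: the count stays or rises by one. The case distinction keeps the
truncated `0 - 1` from contributing at `w = 0`. -/
theorem countProb_succ (hγ : γ ∈ Icc (0 : ℝ) 1) (j : J) (t : ∀ i, T i) (i : Fin n) (w : ℕ) :
    countProb b D γ j t (i + 1) w =
      countProb b D γ j t i w * (1 - allocProb D i (t i) j * openProb γ (boxes b D j) i w) +
        if w = 0 then 0 else countProb b D γ j t i (w - 1) *
          (allocProb D i (t i) j * openProb γ (boxes b D j) i (w - 1)) := by
  classical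
  have hy0 : 0 ≤ allocProb D i (t i) j := ENNReal.toReal_nonneg
  have hy1 : allocProb D i (t i) j ≤ 1 := ENNReal.toReal_le_of_le_ofReal zero_le_one
    ((eventProb_le_one _ _).trans_eq ENNReal.ofReal_one.symm)
  have hs : ∀ w, openProb γ (boxes b D j) i w ∈ Icc (0 : ℝ) 1 := fun w =>
    (isCDF_brokenCDF hγ (boxes_mem b D j) i).openProbOf_mem hγ w
  set y := allocProb D i (t i) j
  have hnn : ∀ w, 0 ≤ y * openProb γ (boxes b D j) i w := fun w => mul_nonneg hy0 (hs w).1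
  have hle : ∀ w, 0 ≤ 1 - y * openProb γ (boxes b D j) i w := fun w =>
    sub_nonneg.2 (mul_le_one₀ hy1 (hs w).1 (hs w).2)
  have hmain : eventProb (postRun b D γ t (i + 1)) (fun o => brokenCount j (i + 1) o = w) =
      eventProb (postRun b D γ t i) (fun o => brokenCount j i o = w) *
        ENNReal.ofReal (1 - y * openProb γ (boxes b D j) i w) +
      eventProb (postRun b D γ t i) (fun o => brokenCount j i o + 1 = w) *
        ENNReal.ofReal (y * openProb γ (boxes b D j) i (w - 1)) := by
    rw [eventProb, postRun_succ, mean_bind, eventProb, eventProb, ← mean_mul_const,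
      ← mean_mul_const, ← mean_add]
    refine mean_congr fun o _ => ?_
    rw [mean_postStep b D hγ j t i o _ (if brokenCount j i o + 1 = w then 1 else 0)
      (if brokenCount j i o = w then 1 else 0), add_comm]
    · unfold opening
      congr 1
      · split_ifs with h
        · rw [h, mul_comm]
        · simp
      · split_ifs with h
        · rw [← h, mul_comm]; rfl
        · simp
    · intro c
      rw [brokenCount_succ_update]
      split_ifs <;> simp_all
  rw [countProb, hmain, ENNReal.toReal_add
    (ENNReal.mul_ne_top (eventProb_ne_top _ _) ENNReal.ofReal_ne_top)
    (ENNReal.mul_ne_top (eventProb_ne_top _ _) ENNReal.ofReal_ne_top), ENNReal.toReal_mul,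
    ENNReal.toReal_mul, ENNReal.toReal_ofReal (hle _), ENNReal.toReal_ofReal (hnn _)]
  congr 1
  cases w with
  | zero => simp [eventProb, mean]
  | succ w => simp [countProb]

/-- Averaged over the types, the number of broken wands has the law tracked by the magician. -/
theorem sum_profileProb_countProb (hγ : γ ∈ Icc (0 : ℝ) 1) (j : J) (m : ℕ) (hm : m ≤ n) (w : ℕ) :
    ∑ t, profileProb b t * countProb b D γ j t m w =
      brokenCDF γ (boxes b D j) m w - prev (brokenCDF γ (boxes b D j) m) w := by
  induction m generalizing w with
  | zero =>
    simp only [countProb_zero, brokenCDF, ← Finset.sum_mul, sum_profileProb, one_mul]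
    cases w <;> simp [prev]
  | succ m ih =>
    have hcongr : ∀ t, countProb b D γ j t (m + 1) w = _ :=
      fun t => countProb_succ b D hγ j t ⟨m, hm⟩ w
    have hupd : ∀ w t r, countProb b D γ j (Function.update t ⟨m, hm⟩ r) m w =
        countProb b D γ j t m w := fun w t r => by
      unfold countProb
      rw [postRun_update b D γ t ⟨m, hm⟩ r m le_rfl]
    -- For fixed types the count need not follow the magician's law. Averaging factors the current
    -- buyer's type out, and her allocation probability is replaced by its mean, the number on the
    -- box.
    have hstay := sum_profileProb_mul_of_indep b ⟨m, hm⟩ (fun t => countProb b D γ j t m w)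
      (hupd w) fun r => 1 - allocProb D ⟨m, hm⟩ r j * openProb γ (boxes b D j) m w
    have hmove := sum_profileProb_mul_of_indep b ⟨m, hm⟩
      (fun t => countProb b D γ j t m (w - 1)) (hupd (w - 1))
      fun r => allocProb D ⟨m, hm⟩ r j * openProb γ (boxes b D j) m (w - 1)
    have hbox := boxes_eq b D j ⟨m, hm⟩
    simp only at hbox
    have h1 : ∀ s, ∑ r, (b ⟨m, hm⟩).prob r * (allocProb D ⟨m, hm⟩ r j * s) =
        boxes b D j m * s := fun s => by
      rw [hbox, Finset.sum_mul]
      exact Finset.sum_congr rfl fun r _ => by ring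
    simp only [mul_sub, mul_one, Finset.sum_sub_distrib, (b ⟨m, hm⟩).prob_sum, h1,
      ih (by omega)] at hstay
    simp only [h1, ih (by omega)] at hmove
    simp only [hcongr, mul_add, Finset.sum_add_distrib, mul_sub, mul_one, Finset.sum_sub_distrib]
    cases w with
    | zero =>
      simp only [ih (by omega)] at hstay ⊢
      simp only [if_true, mul_zero, Finset.sum_const_zero, brokenCDF, prev] at hstay ⊢
      rw [hstay]
      simp only [openProb]
      ring
    | succ w =>
      simp only [Nat.add_sub_cancel, Nat.add_one_ne_zero, if_false, ih (by omega : m ≤ n)] at hmove ⊢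
      rw [hstay, hmove]
      simp only [brokenCDF, prev, openProb]
      ring

/-- A function of the number of broken wands, averaged over the run. -/
theorem mean_comp_brokenCount (j : J) (t : ∀ i, T i) (m : ℕ) (f : ℕ → ℝ) (hf : ∀ w, 0 ≤ f w) :
    (mean (postRun b D γ t m) fun o => ENNReal.ofReal (f (brokenCount j m o))).toReal =
      ∑ w ∈ Finset.range (m + 1), countProb b D γ j t m w * f w := by
  classical
  have : (mean (postRun b D γ t m) fun o => ENNReal.ofReal (f (brokenCount j m o))) =
      ∑ w ∈ Finset.range (m + 1),
        eventProb (postRun b D γ t m) (fun o => brokenCount j m o = w) * ENNReal.ofReal (f w) := by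
    simp only [eventProb, ← mean_mul_const, ← mean_sum]
    refine mean_congr fun o _ => ?_
    simp only [ite_mul, one_mul, zero_mul, Finset.sum_ite_eq, Finset.mem_range]
    rw [if_pos (Nat.lt_succ_of_le (brokenCount_le j m o))]
  rw [this, ENNReal.toReal_sum fun w _ =>
    ENNReal.mul_ne_top (eventProb_ne_top _ _) ENNReal.ofReal_ne_top]
  refine Finset.sum_congr rfl fun w _ => ?_
  rw [ENNReal.toReal_mul, ENNReal.toReal_ofReal (hf w)]
  rfl

/-- Later steps update only the entries of later buyers. -/
theorem eventProb_mem_postRun (j : J) (t : ∀ i, T i) (i : Fin n) (m : ℕ) (hi : i < m)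
    (hm : m ≤ n) :
    eventProb (postRun b D γ t m) (fun o => j ∈ (o i).1) =
      eventProb (postRun b D γ t (i + 1)) (fun o => j ∈ (o i).1) := by
  classical
  induction m, hi using Nat.le_induction with
  | base => rfl
  | succ m hi ih =>
    rw [← ih (by omega)]
    have hrun := postRun_succ b D γ t ⟨m, hm⟩
    simp only at hrun
    have hne : i ≠ ⟨m, hm⟩ := fun h => by rw [h] at hi; simp at hi
    rw [eventProb_eq_mean, hrun, mean_bind, eventProb_eq_mean]
    refine mean_congr fun o _ => ?_
    rw [← mean_const (postStep b D γ t ⟨m, hm⟩ o) (if j ∈ (o i).1 then 1 else 0)]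
    refine mean_congr fun o' ho' => ?_
    obtain ⟨c, -, S, -, rfl⟩ := mem_support_postStep b D γ ho'
    rw [Function.update_of_ne hne]

/-- Probability that buyer `i` keeps item `j`. -/
theorem toReal_eventProb_mem_postRun (hγ : γ ∈ Icc (0 : ℝ) 1) (j : J) (t : ∀ i, T i) (i : Fin n) :
    (eventProb (postRun b D γ t n) (fun o => j ∈ (o i).1)).toReal =
      (∑ w ∈ Finset.range (i + 1), countProb b D γ j t i w * openProb γ (boxes b D j) i w) *
        allocProb D i (t i) j := by
  classical
  have hs : ∀ w, openProb γ (boxes b D j) i w ∈ Icc (0 : ℝ) 1 := fun w =>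
    (isCDF_brokenCDF hγ (boxes_mem b D j) i).openProbOf_mem hγ w
  rw [eventProb_mem_postRun b D j t i n i.2 le_rfl, eventProb_eq_mean, postRun_succ, mean_bind,
    Finset.sum_mul]
  have : ∀ o ∈ (postRun b D γ t i).support, mean (postStep b D γ t i o)
      (fun o => if j ∈ (o i).1 then 1 else 0) =
      ENNReal.ofReal (allocProb D i (t i) j * openProb γ (boxes b D j) i (brokenCount j i o)) :=
    fun o _ => by
      rw [mean_postStep b D hγ j t i o _ 1 0 fun c => by simp, mul_zero, mul_one, add_zero]
      rfl
  rw [mean_congr this, mean_comp_brokenCount b D j t i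
    (fun w => allocProb D i (t i) j * openProb γ (boxes b D j) i w)
    fun w => mul_nonneg ENNReal.toReal_nonneg (hs w).1]
  exact Finset.sum_congr rfl fun w _ => by ring

/-- Averaged over the types of the other buyers, every tentative item is kept with probability
exactly `γ`. -/
theorem measureReal_mem_induced_postRounding (hγ : γ ∈ Icc (0 : ℝ) 1) (i : Fin n) (r : T i)
    (j : J) :
    (induced b (postRounding b D γ) i r).real {o | j ∈ o.1} = γ * allocProb D i r j := by
  have hP : ∀ t, IsProbabilityMeasure (postRounding b D γ t) := fun t => by
    unfold postRounding; infer_instance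
  have hm : MeasurableSet {o : Finset J × ℝ | j ∈ o.1} :=
    measurable_fst (MeasurableSet.of_discrete (s := {S : Finset J | j ∈ S}))
  have hreal : ∀ t, (postRounding b D γ t).real {o | o i ∈ {o : Finset J × ℝ | j ∈ o.1}} =
      (eventProb (postRun b D γ t n) (fun o => j ∈ (o i).1)).toReal := fun t =>
    measureReal_toMeasure _ ((measurable_pi_apply i) hm)
  rw [measureReal_induced b _ i r hm]
  -- The report of buyer `i` cannot influence the wands broken before her turn, so opening is
  -- independent of it.
  have hupd : ∀ t w, countProb b D γ j (Function.update t i r) i w =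
      countProb b D γ j t i w := fun t w => by
    unfold countProb
    rw [postRun_update b D γ t i r i le_rfl]
  simp only [hreal, toReal_eventProb_mem_postRun b D hγ, hupd, Function.update_self]
  simp only [← mul_assoc, ← Finset.sum_mul, Finset.mul_sum]
  rw [Finset.sum_comm]
  simp only [← Finset.sum_mul, sum_profileProb_countProb b D hγ j i i.2.le]
  congr 1
  -- What remains is the opening probability averaged over the law of the count, which telescopes to
  -- `γ`.
  refine Eq.trans ?_ ((isCDF_brokenCDF hγ (boxes_mem b D j) i).sum_openProbOf_mul hγ)
  exact Finset.sum_congr rfl fun w _ => mul_comm _ _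

end Run

/-! ### Post-rounding of LP-based mechanisms -/

section PostRounding

variable {J : Type*} [Fintype J] [DecidableEq J] {n : ℕ} {T : Fin n → Type*} [∀ i, Fintype (T i)]
  {b : ∀ i, Buyer J (T i)} (m : ∀ i, LPMechanism (b i)) {Q : Fin n → J → ℝ} {γ : ℝ}

instance isProbabilityMeasure_postRounding (D : ∀ i, T i → PMF (Finset J × ℝ)) (t : ∀ i, T i) :
    IsProbabilityMeasure (postRounding b D γ t) := by
  unfold postRounding
  infer_instance

/-- Whatever boxes open, a kept bundle is a subset of an independent tentative bundle. Values
therefore stay additive after rounding. -/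
theorem ae_postRounding_indep (hQ : ∀ i, Q i ∈ Icc (0 : J → ℝ) 1) (t : ∀ i, T i) (i : Fin n) :
    ∀ᵐ o ∂(postRounding b (fun i => (m i).mech (Q i)) γ t),
      (b i).mat.Indep ((o i).1 : Set J) := by
  refine ae_toMeasure_of_support _ fun o ho => ?_
  obtain ⟨c, hc, hsub, -⟩ := exists_tentative_of_mem_support b _ γ le_rfl ho i i.2
  exact ((m i).indep_of_mem_support (hQ i) _ hc).subset (by exact_mod_cast hsub)

theorem ae_postRounding_payment (t : ∀ i, T i) (i : Fin n) :
    ∀ᵐ o ∂(postRounding b (fun i => (m i).mech (Q i)) γ t),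
      (o i).2 = γ * (m i).pay (Q i) (t i) := by
  refine ae_toMeasure_of_support _ fun o ho => ?_
  obtain ⟨c, hc, -, hpay⟩ := exists_tentative_of_mem_support b _ γ le_rfl ho i i.2
  rw [hpay, (m i).payment_of_mem_support _ hc]

theorem ae_induced_postRounding_indep (hQ : ∀ i, Q i ∈ Icc (0 : J → ℝ) 1) (i : Fin n) (r : T i) :
    ∀ᵐ o ∂(induced b (postRounding b (fun i => (m i).mech (Q i)) γ) i r),
      (b i).mat.Indep (o.1 : Set J) :=
  ae_induced b _ i r
    (measurable_fst (MeasurableSet.of_discrete (s := {S : Finset J | (b i).mat.Indep (S : Set J)})))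
    fun _ => ae_postRounding_indep m hQ _ i

theorem ae_induced_postRounding_payment (i : Fin n) (r : T i) :
    ∀ᵐ o ∂(induced b (postRounding b (fun i => (m i).mech (Q i)) γ) i r),
      o.2 = γ * (m i).pay (Q i) r :=
  ae_induced b _ i r (measurable_snd (measurableSet_singleton _)) fun t => by
    have := ae_postRounding_payment (γ := γ) (Q := Q) m (Function.update t i r) i
    rwa [Function.update_self] at this

/-- Post-rounding scales the expected utility of every type under every report. -/
theorem utility_induced_postRounding (hQ : ∀ i, Q i ∈ Icc (0 : J → ℝ) 1)
    (hγ : γ ∈ Icc (0 : ℝ) 1) (i : Fin n) (s r : T i) :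
    (b i).utility s (induced b (postRounding b (fun i => (m i).mech (Q i)) γ) i r) =
      γ * (∑ j, (b i).val s j * (m i).alloc (Q i) r j - (m i).pay (Q i) r) := by
  have := isProbabilityMeasure_induced b (postRounding b (fun i => (m i).mech (Q i)) γ) i r
  rw [(b i).utility_eq_of_const_payment s _ _ (ae_induced_postRounding_indep m hQ i r)
    (ae_induced_postRounding_payment m i r)]
  -- Additivity leaves only the marginals, each scaled by `γ`; correlations between the magicians of
  -- different items play no role.
  simp only [measureReal_mem_induced_postRounding b _ hγ, allocProb_eq,
    (m i).measureReal_mem (hQ i)]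
  rw [mul_sub, Finset.mul_sum]
  congr 1
  exact Finset.sum_congr rfl fun j _ => by ring

theorem isFeasible_induced_postRounding (hQ : ∀ i, Q i ∈ Icc (0 : J → ℝ) 1)
    (hγ : γ ∈ Icc (0 : ℝ) 1) (i : Fin n) :
    (b i).IsFeasible (induced b (postRounding b (fun i => (m i).mech (Q i)) γ) i) where
  isProb r := isProbabilityMeasure_induced b _ i r
  indep _ r := ae_induced_postRounding_indep m hQ i r
  payment r := by
    filter_upwards [ae_induced_postRounding_payment m i r] with o ho
    have hp := ((m i).optimal _ (hQ i)).1.payment r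
    rw [ho]
    exact ⟨mul_nonneg hγ.1 hp.1, (mul_le_of_le_one_left hp.1 hγ.2).trans hp.2⟩
  truthful s r := by
    rw [utility_induced_postRounding m hQ hγ, utility_induced_postRounding m hQ hγ]
    exact mul_le_mul_of_nonneg_left (((m i).optimal _ (hQ i)).1.truthful s r) hγ.1
  rational h s := by
    rw [utility_induced_postRounding m hQ hγ]
    exact mul_nonneg hγ.1 (((m i).optimal _ (hQ i)).1.rational h s)

theorem isFeasibleMulti_postRounding {units : J → ℕ} {k : ℕ} (hk : 1 ≤ k)
    (hunits : ∀ j, k ≤ units j) (hQ : CapsFeasible units Q) (hγ : γ ∈ Icc 0 (gammaConst k)) :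
    IsFeasibleMulti b units (postRounding b (fun i => (m i).mech (Q i)) γ) := by
  obtain ⟨hγ1, hthr⟩ := threshold_lt_of_le_gammaConst hk hγ
  refine ⟨fun t => inferInstance, fun t j => ae_toMeasure_of_support _ fun o ho => ?_,
    isFeasible_induced_postRounding m hQ.1 ⟨hγ.1, hγ1⟩⟩
  -- The boxes carry exact ex ante probabilities, which are at most the caps, so their sum is within
  -- the supply. The magician of item `j` then has `units j ≥ k` wands, as in the definition of
  -- `gammaConst k`.
  have hsum : ∑ i ∈ Finset.range n, boxes b (fun i => (m i).mech (Q i)) j i ≤ units j := by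
    rw [Finset.sum_range]
    refine (Finset.sum_le_sum fun i _ => ?_).trans (hQ.2 j)
    simpa [boxes] using (m i).exAnte_mech_le (hQ.1 i) j
  have := brokenCount_le_of_mem_support b (fun i => (m i).mech (Q i)) γ j
    (hthr (units j) (hunits j) n _ (boxes_mem b _ j) hsum) le_rfl ho
  simpa [brokenCount] using this

/-- Given the types, payments are deterministic and do not depend on which items are kept, so the
revenue is an exact multiple of the benchmark. -/
theorem multiRevenue_postRounding (hQ : ∀ i, Q i ∈ Icc (0 : J → ℝ) 1) :
    multiRevenue b (postRounding b (fun i => (m i).mech (Q i)) γ) =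
      γ * ∑ i, (b i).benchmark (Q i) := by
  rw [Finset.mul_sum]
  refine Finset.sum_congr rfl fun i _ => ?_
  have : ∀ t, ∫ o, (o i).2 ∂(postRounding b (fun i => (m i).mech (Q i)) γ t) =
      γ * (m i).pay (Q i) (t i) := fun t => by
    rw [integral_congr_ae (ae_postRounding_payment m t i)]
    simp
  simp only [this]
  rw [sum_profileProb_coord b i fun r => γ * (m i).pay (Q i) r,
    ((m i).optimal _ (hQ i)).benchmark_eq, Finset.mul_sum]
  exact Finset.sum_congr rfl fun r _ => by ring

end PostRounding

end CorrAuction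

end

/-! ### Assembly of the theorem -/

open CorrAuction
theorem mainTheorem10 {J : Type*} [Fintype J] [DecidableEq J] {n : ℕ} {T : Fin n → Type*}
    [∀ i, Fintype (T i)] (b : ∀ i, Buyer J (T i))
    (units : J → ℕ) (k : ℕ) (hk : 1 ≤ k) (hunits : ∀ j, k ≤ units j) :
    -- the linear program has an optimal assignment under every cap
    (∀ i, ∀ q ∈ Set.Icc (0 : J → ℝ) 1, ∃ x p, (b i).LPOptimal q x p) ∧
    -- the marginals of a feasible assignment can be rounded to random independent sets
    (∀ i, ∀ q x p, (b i).LPFeasible q x p → ∀ t, ∃ L, IsRounding (b i).mat (x t) L) ∧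
    -- for every choice of optimal assignments and roundings:
    ∀ m : ∀ i, LPMechanism (b i),
      -- the mechanism is optimal, and its revenue is the optimal value of the linear program
      (∀ i, ∀ q ∈ Set.Icc (0 : J → ℝ) 1,
        (b i).IsOptimalUnderCap q (toMech ((m i).mech q)) ∧
        (b i).revenue (toMech ((m i).mech q)) = (b i).benchmark q) ∧
      -- its exact ex ante allocation rule is read off the solution of the linear program
      (∀ i, ∀ q ∈ Set.Icc (0 : J → ℝ) 1, ∀ j,
        (b i).exAnte (toMech ((m i).mech q)) j = ∑ t, (b i).prob t * (m i).alloc q t j) ∧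
      -- it satisfies the requirements of post-rounding
      (∀ i, PostRoundingRequirements (b i) (fun _ _ pay => pay) 1 (b i).benchmark
        (m i).mech (m i).alloc) ∧
      -- post-rounding with optimal caps gives feasible (BIC) approximately optimal mechanisms
      (∃ Q, CapsOptimal (fun i => (b i).benchmark) units Q) ∧
      ∀ Q, CapsOptimal (fun i => (b i).benchmark) units Q →
        ∀ γ ∈ Set.Icc 0 (gammaConst k),
          IsFeasibleMulti b units (postRounding b (fun i => (m i).mech (Q i)) γ) ∧
          ∀ M, IsFeasibleMulti b units M →
            γ * multiRevenue b M ≤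
              multiRevenue b (postRounding b (fun i => (m i).mech (Q i)) γ) := by
  refine ⟨fun i q hq => (b i).exists_lpOptimal hq, fun i q x p h t =>
    exists_isRounding _ (b i).ground _ (fun j => (h.alloc t j).1) (h.rank t), fun m =>
    ⟨fun i q hq => ⟨(m i).isOptimalUnderCap_mech hq, (m i).revenue_mech hq⟩,
      fun i q hq j => (m i).exAnte_mech hq j, fun i => (m i).postRoundingRequirements,
      exists_capsOptimal b units, fun Q hQ γ hγ =>
      ⟨isFeasibleMulti_postRounding m hk hunits hQ.1 hγ, fun M hM => ?_⟩⟩⟩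
  rw [multiRevenue_postRounding m hQ.1.1]
  exact mul_le_mul_of_nonneg_left (hM.multiRevenue_le hQ) hγ.1
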